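/- **Conventions.** Let $1\to G\xrightarrow{i}\Gamma\xrightarrow{\sigma}\Pi\to 1$ be an extension of discrete groups. $H_b^n(\cdot,\mathbb R)$ is real bounded cohomology, computed from bounded inhomogeneous cochains with the usual coboundary. $\Gamma$ acts on $G$ by conjugation, hence on $H_b^2(G,\mathbb R)$; this action factors through $\Pi$, and $H_b^2(G,\mathbb R)^\Pi$ is the space of invariant classes. The outer representation $\theta:\Pi\to\mathrm{Out}(G)$ sends $\sigma(\gamma)$ to the outer class of conjugation by $\gamma$. **The transgression operator.** An abstract kernel of $\theta$ is a pair $(\Psi,f)$, where $\Psi:\Pi\to\mathrm{Aut}(G)$ is a set-theoretic lift of $\theta$ and $f:\Pi\times\Pi\to G$ satisfies $\Psi(\alpha)\circ\Psi(\beta)=i_{f(\alpha,\beta)}\circ\Psi(\alpha\beta)$, with $i_g(h)=ghg^{-1}$. Every $x\in H_b^2(G,\mathbb R)$ is represented by a unique homogeneous bounded $2$-cocycle $c_x$, that is, one with $c_x(g^m,g^n)=0$ for all $g\in G$, $m,n\in\mathbb N$. Let $\overline G=\mathbb R\times G$ with the product $(s,g)(t,h)=(s+t+c_x(g,h),gh)$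 be the corresponding central extension, with projection $p:\overline G\to G$, central inclusion $j(t)=(t,1)$, section $s_x(g)=(0,g)$ and homogeneous quasi-morphism $\varphi(t,g)=t$. Put $F_x=s_x\circ f$, $\overline\Psi(\alpha)(y)=s_x\big(\Psi(\alpha)(p(y))\big)\,j(\varphi(y))$ and $$K(\alpha,\beta,\gamma)=\overline\Psi(\alpha)\big(F_x(\beta,\gamma)\big)\,F_x(\alpha,\beta\gamma)\,F_x(\alpha\beta,\gamma)^{-1}\,F_x(\alpha,\beta)^{-1}\in\overline G .$$ If $x$ is $\Pi$-invariant, the composition cochain $\varphi\circ K:\Pi^3\to\mathbb R$ is a bounded $3$-cocycle, and the transgression operator is the linear map $$\delta:H_b^2(G,\mathbb R)^\Pi\to H_b^3(\Pi,\mathbb R),\qquad \delta(x)=[\varphi\circ K].$$ **The spectral sequence.** Let $U^q$ be the space of bounded functions $\Gamma^{q+1}\to\mathbb R$ invariant under diagonal left translation by $G$, with the translation action of $\Pi=\Gamma/G$, and let $K^{p,q}=C_b^p(\Pi,U^q)$ be the space of bounded inhomogeneous $p$-cochains. Let $d_\Pi$ be the inhomogeneous coboundary and $d_U$ the one induced by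 the alternating sum $U^q\to U^{q+1}$. The total complex $\mathrm{Tot}^n=\bigoplus_{p+q=n}K^{p,q}$ has differential $d=d_\Pi+(-1)^pd_U$ and filtration $F^p\mathrm{Tot}=\sum_{i\ge p}K^{i,j}$. Put $$Z_r^{p,q}=\{x\in F^p\mathrm{Tot}^{p+q}: dx\in F^{p+r}\mathrm{Tot}^{p+q+1}\},\qquad B_r^{p,q}=F^p\mathrm{Tot}^{p+q}\cap d\big(F^{p-r}\mathrm{Tot}^{p+q-1}\big),$$ $$E_r^{p,q}=Z_r^{p,q}/(Z_{r-1}^{p+1,q-1}+B_{r-1}^{p,q}),\qquad d_r^{p,q}:E_r^{p,q}\to E_r^{p+r,q-r+1},\quad [x]\mapsto[dx].$$ **Statement.** For every extension as above and every abstract kernel $(\Psi,f)$ of $\theta$: 1. The map sending the class of $x=x^{0,2}+x^{1,1}+x^{2,0}$ to the class of the restriction $(g_1,g_2)\mapsto x^{0,2}(1,i(g_1),i(g_1g_2))$ is a linear bijection $\iota:E_3^{0,2}\to H_b^2(G,\mathbb R)^\Pi$. 2. Viewing a bounded $3$-cocycle on $\Pi$ as an element of $K^{3,0}$ whose values are constant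 functions induces a linear bijection $\kappa:H_b^3(\Pi,\mathbb R)\to E_3^{3,0}$. 3. Under these identifications the transgression operator equals the differential $d_3^{0,2}:E_3^{0,2}\to E_3^{3,0}$: $$\delta=\kappa^{-1}\circ d_3^{0,2}\circ\iota^{-1}.$$ -/

import Mathlib

namespace BddCoh

/-! ### Cochain differentials -/

section Differentials

/-- The homogeneous coboundary
`(δ f)(x₀, …, xₙ₊₁) = ∑ᵢ (-1)ⁱ f(x₀, …, x̂ᵢ, …, xₙ₊₁)`. -/
def altD (X V : Type*) [AddCommGroup V] [Module ℝ V] (n : ℕ) :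
    ((Fin (n + 1) → X) → V) →ₗ[ℝ] ((Fin (n + 2) → X) → V) where
  toFun f x := ∑ i : Fin (n + 2), (-1 : ℝ) ^ (i : ℕ) • f (fun j => x (i.succAbove j))
  map_add' f g := by
    ext x
    simp [smul_add, Finset.sum_add_distrib]
  map_smul' r f := by
    ext x
    simp [Finset.smul_sum, smul_comm r]

/-- The inhomogeneous coboundary with coefficients in a representation `ρ` of `G` on `V`:
`(d f)(g₁, …, gₙ₊₁) = g₁ • f(g₂, …, gₙ₊₁) + ∑ᵢ (-1)ⁱ f(g₁, …, gᵢgᵢ₊₁, …, gₙ₊₁)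
  + (-1)ⁿ⁺¹ f(g₁, …, gₙ)`
(the last term is the summand `j = n` below). -/
def inhomD {G V : Type*} [Group G] [AddCommGroup V] [Module ℝ V] (ρ : Representation ℝ G V)
    (n : ℕ) : ((Fin n → G) → V) →ₗ[ℝ] ((Fin (n + 1) → G) → V) where
  toFun f g := ρ (g 0) (f fun i => g i.succ) +
    ∑ j : Fin (n + 1), (-1 : ℝ) ^ ((j : ℕ) + 1) • f (Fin.contractNth j (· * ·) g)
  map_add' f g := by
    ext x
    simp [smul_add, Finset.sum_add_distrib, add_add_add_comm]
  map_smul' r f := by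
    ext x
    simp [Finset.smul_sum, smul_comm r]

theorem altD_altD {X V : Type*} [AddCommGroup V] [Module ℝ V] (n : ℕ)
    (f : (Fin (n + 1) → X) → V) : altD X V (n + 1) (altD X V n f) = 0 := by
  ext x
  simp only [altD, LinearMap.coe_mk, AddHom.coe_mk, Pi.zero_apply, Finset.smul_sum]
  rw [← Finset.sum_product']
  refine Finset.sum_involution
    (fun a _ => (a.1.succAbove a.2, a.2.predAbove a.1)) ?_ ?_ ?_ ?_
  · rintro ⟨i, j⟩ -
    simp only [smul_smul, ← pow_add, Fin.neg_one_pow_succAbove_add_predAbove,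
      Fin.succAbove_succAbove_succAbove_predAbove, neg_smul]
    simp
  · rintro ⟨i, j⟩ - - h
    exact Fin.succAbove_ne i j (congrArg Prod.fst h)
  · simp
  · rintro ⟨i, j⟩ -
    refine Prod.ext (Fin.succAbove_succAbove_predAbove i j) ?_
    refine Fin.succAbove_right_injective (p := i) ?_
    have h1 := Fin.succAbove_succAbove_predAbove (i.succAbove j) (j.predAbove i)
    simpa [Fin.succAbove_succAbove_predAbove] using h1

/-- The homogeneous cochain attached to an inhomogeneous one. -/
def toHom {G V : Type*} [Group G] [AddCommGroup V] [Module ℝ V] (ρ : Representation ℝ G V)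
    {n : ℕ} (f : (Fin n → G) → V) : (Fin (n + 1) → G) → V :=
  fun a => ρ (a 0) (f fun i => (a i.castSucc)⁻¹ * a i.succ)

theorem inhomD_eq {G V : Type*} [Group G] [AddCommGroup V] [Module ℝ V]
    (ρ : Representation ℝ G V) {n : ℕ} (f : (Fin n → G) → V) (g : Fin (n + 1) → G) :
    inhomD ρ n f g = altD G V n (toHom ρ f) (Fin.partialProd g) := by
  simp only [inhomD, altD, toHom, LinearMap.coe_mk, AddHom.coe_mk]
  conv_rhs => rw [Fin.sum_univ_succ]
  congr 1
  · simp only [Fin.val_zero, pow_zero, one_smul, Fin.zero_succAbove]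
    congr 1
    · congr 1
      simpa using (Fin.partialProd_succ g 0).symm
    · congr 1
      ext i
      simp only [Fin.succ_castSucc]
      exact (Fin.partialProd_right_inv g i.succ).symm
  · refine Finset.sum_congr rfl fun j _ => ?_
    simp only [Fin.val_succ]
    congr 1
    have h0 : j.succ.succAbove 0 = 0 := by simp
    rw [h0]
    simp only [Fin.partialProd_zero, map_one, Module.End.one_apply]
    congr 1
    ext k
    rw [Fin.succ_succAbove_succ]
    exact (Fin.inv_partialProd_mul_eq_contractNth g j k).symm

theorem toHom_inhomD {G V : Type*} [Group G] [AddCommGroup V] [Module ℝ V]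
    (ρ : Representation ℝ G V) {n : ℕ} (f : (Fin n → G) → V) :
    toHom ρ (inhomD ρ n f) = altD G V n (toHom ρ f) := by
  ext a
  have ha : (a 0 • Fin.partialProd fun i : Fin (n + 1) => (a i.castSucc)⁻¹ * a i.succ) = a :=
    Fin.partialProd_left_inv a
  have hinv : ∀ (u : G) (b : Fin (n + 1) → G),
      toHom ρ f (fun i => u * b i) = ρ u (toHom ρ f b) := by
    intro u b
    simp [toHom, map_mul, mul_assoc]
  change ρ (a 0) (inhomD ρ n f _) = _
  rw [inhomD_eq]
  conv_rhs => rw [← ha]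
  simp only [altD, LinearMap.coe_mk, AddHom.coe_mk, map_sum, map_smul, Pi.smul_apply,
    smul_eq_mul]
  refine Finset.sum_congr rfl fun j _ => ?_
  rw [hinv]

theorem inhomD_inhomD {G V : Type*} [Group G] [AddCommGroup V] [Module ℝ V]
    (ρ : Representation ℝ G V) (n : ℕ) (f : (Fin n → G) → V) :
    inhomD ρ (n + 1) (inhomD ρ n f) = 0 := by
  ext g
  rw [inhomD_eq, toHom_inhomD, altD_altD]
  rfl

end Differentials

/-! ### Real bounded cohomology of a group -/

section BoundedCohomology

/-- Bounded real inhomogeneous `n`-cochains on `G`. -/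
def Cb (G : Type*) (n : ℕ) : Submodule ℝ ((Fin n → G) → ℝ) where
  carrier := {f | ∃ C : ℝ, ∀ g, |f g| ≤ C}
  zero_mem' := ⟨0, by simp⟩
  add_mem' := by
    rintro f f' ⟨C, hC⟩ ⟨C', hC'⟩
    exact ⟨C + C', fun g => (abs_add_le _ _).trans (add_le_add (hC g) (hC' g))⟩
  smul_mem' := by
    rintro r f ⟨C, hC⟩
    refine ⟨|r| * C, fun g => ?_⟩
    simpa [abs_mul] using mul_le_mul_of_nonneg_left (hC g) (abs_nonneg r)

/-- The inhomogeneous coboundary with trivial real coefficients. -/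
def dR (G : Type*) [Group G] (n : ℕ) :
    ((Fin n → G) → ℝ) →ₗ[ℝ] ((Fin (n + 1) → G) → ℝ) :=
  inhomD (Representation.trivial ℝ G ℝ) n

/-- Bounded `n`-cocycles. -/
def Zb (G : Type*) [Group G] (n : ℕ) : Submodule ℝ ((Fin n → G) → ℝ) :=
  Cb G n ⊓ LinearMap.ker (dR G n)

/-- Coboundaries of bounded `(n-1)`-cochains. -/
def Bb (G : Type*) [Group G] : (n : ℕ) → Submodule ℝ ((Fin n → G) → ℝ)
  | 0 => ⊥
  | n + 1 => (Cb G n).map (dR G n)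

/-- Real bounded cohomology `H_b^n(G, ℝ)`. -/
abbrev Hb (G : Type*) [Group G] (n : ℕ) : Type _ :=
  Zb G n ⧸ (Bb G n).comap (Zb G n).subtype

/-- The class of a bounded cocycle. -/
abbrev Hb.mk (G : Type*) [Group G] (n : ℕ) : Zb G n →ₗ[ℝ] Hb G n :=
  ((Bb G n).comap (Zb G n).subtype).mkQ

/-- Pull-back of cochains along a homomorphism. -/
def pull {G H : Type*} [Group G] [Group H] (φ : G →* H) (n : ℕ) :
    ((Fin n → H) → ℝ) →ₗ[ℝ] ((Fin n → G) → ℝ) where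
  toFun f g := f (fun i => φ (g i))
  map_add' _ _ := rfl
  map_smul' _ _ := rfl

theorem dR_pull {G H : Type*} [Group G] [Group H] (φ : G →* H) (n : ℕ)
    (f : (Fin n → H) → ℝ) : dR G n (pull φ n f) = pull φ (n + 1) (dR H n f) := by
  ext g
  simp only [dR, inhomD, pull, LinearMap.coe_mk, AddHom.coe_mk,
    Representation.trivial_apply]
  congr 1
  refine Finset.sum_congr rfl fun j _ => ?_
  congr 2
  exact Fin.comp_contractNth _ _ (map_mul φ) j g

theorem pull_mem_Cb {G H : Type*} [Group G] [Group H] (φ : G →* H) (n : ℕ)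
    {f : (Fin n → H) → ℝ} (hf : f ∈ Cb H n) : pull φ n f ∈ Cb G n := by
  obtain ⟨C, hC⟩ := hf
  exact ⟨C, fun g => hC _⟩

theorem pull_mem_Zb {G H : Type*} [Group G] [Group H] (φ : G →* H) (n : ℕ)
    {f : (Fin n → H) → ℝ} (hf : f ∈ Zb H n) : pull φ n f ∈ Zb G n := by
  refine ⟨pull_mem_Cb φ n hf.1, ?_⟩
  have h : dR H n f = 0 := hf.2
  change dR G n (pull φ n f) = 0
  rw [dR_pull, h, map_zero]

theorem pull_mem_Bb {G H : Type*} [Group G] [Group H] (φ : G →* H) (n : ℕ)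
    {f : (Fin n → H) → ℝ} (hf : f ∈ Bb H n) : pull φ n f ∈ Bb G n := by
  cases n with
  | zero =>
    have h : f = 0 := hf
    rw [h, map_zero]
    exact zero_mem _
  | succ n =>
    obtain ⟨b, hb, rfl⟩ := hf
    exact ⟨pull φ n b, pull_mem_Cb φ n hb, dR_pull φ n b⟩

/-- The operator `φ_b : H_b^n(H, ℝ) → H_b^n(G, ℝ)` induced by a homomorphism `φ : G → H`. -/
def Hb.map {G H : Type*} [Group G] [Group H] (φ : G →* H) (n : ℕ) : Hb H n →ₗ[ℝ] Hb G n :=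
  Submodule.mapQ _ _ ((pull φ n).restrict fun _ hf => pull_mem_Zb φ n hf)
    fun _ hf => pull_mem_Bb φ n hf

/-- The subspace `H_b^n(G, ℝ)^Π` of invariant classes for an extension `1 → G → Γ → Π → 1`.
The group `Γ` acts on `H_b^n(G, ℝ)` through its conjugation action on `G`; inner automorphisms of
`G` act trivially on bounded cohomology, so this is the action of `Π = Γ / G` induced by the outer
representation `Π → Out(G)`, and the invariants of `Π` are those of `Γ`. -/
def Hb.invariants {G Γ Q : Type*} [Group G] [Group Γ] [Group Q] (S : GroupExtension G Γ Q)
    (n : ℕ) : Submodule ℝ (Hb G n) where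
  carrier := {x | ∀ γ : Γ, Hb.map (S.conjAct γ).toMonoidHom n x = x}
  zero_mem' _ := map_zero _
  add_mem' hx hy γ := by rw [map_add, hx γ, hy γ]
  smul_mem' r x hx γ := by rw [map_smul, hx γ]

end BoundedCohomology

/-! ### Homogeneous bounded 2-cocycles -/

section Homogeneous

theorem dR_two_apply {G : Type*} [Group G] (c : (Fin 2 → G) → ℝ) (g h k : G) :
    dR G 2 c ![g, h, k] = c ![h, k] - c ![g * h, k] + c ![g, h * k] - c ![g, h] := by
  have e0 : (fun i : Fin 2 => (![g, h, k] : Fin 3 → G) i.succ) = ![h, k] := by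
    ext i; fin_cases i <;> rfl
  have e1 : Fin.contractNth 0 (· * ·) (![g, h, k] : Fin 3 → G) = ![g * h, k] := by
    ext i; fin_cases i <;> rfl
  have e2 : Fin.contractNth 1 (· * ·) (![g, h, k] : Fin 3 → G) = ![g, h * k] := by
    ext i; fin_cases i <;> rfl
  have e3 : Fin.contractNth 2 (· * ·) (![g, h, k] : Fin 3 → G) = ![g, h] := by
    ext i; fin_cases i <;> rfl
  change c (fun i : Fin 2 => (![g, h, k] : Fin 3 → G) i.succ) + ∑ j : Fin 3,
    (-1 : ℝ) ^ ((j : ℕ) + 1) • c (Fin.contractNth j (· * ·) ![g, h, k]) = _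
  rw [Fin.sum_univ_three, e0, e1, e2, e3]
  norm_num
  ring

theorem dR_one_apply {G : Type*} [Group G] (b : (Fin 1 → G) → ℝ) (g h : G) :
    dR G 1 b ![g, h] = b ![h] - b ![g * h] + b ![g] := by
  have e0 : (fun i : Fin 1 => (![g, h] : Fin 2 → G) i.succ) = ![h] := by
    ext i; fin_cases i; rfl
  have e1 : Fin.contractNth 0 (· * ·) (![g, h] : Fin 2 → G) = ![g * h] := by
    ext i; fin_cases i; rfl
  have e2 : Fin.contractNth 1 (· * ·) (![g, h] : Fin 2 → G) = ![g] := by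
    ext i; fin_cases i; rfl
  change b (fun i : Fin 1 => (![g, h] : Fin 2 → G) i.succ) + ∑ j : Fin 2,
    (-1 : ℝ) ^ ((j : ℕ) + 1) • b (Fin.contractNth j (· * ·) ![g, h]) = _
  rw [Fin.sum_univ_two, e0, e1, e2]
  norm_num
  ring

theorem Zb_two_cocycle {G : Type*} [Group G] {c : (Fin 2 → G) → ℝ} (hc : c ∈ Zb G 2)
    (g h k : G) : c ![g, h] + c ![g * h, k] = c ![h, k] + c ![g, h * k] := by
  have h0 : dR G 2 c = 0 := hc.2
  have h1 := congrFun h0 ![g, h, k]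
  rw [dR_two_apply] at h1
  simp only [Pi.zero_apply] at h1
  linarith

/-- Homogeneous bounded `2`-cocycles: those with `c(gᵐ, gⁿ) = 0` for all `g ∈ G`, `m, n ∈ ℕ`. -/
def ZbHom (G : Type*) [Group G] : Submodule ℝ ((Fin 2 → G) → ℝ) where
  carrier := {c | c ∈ Zb G 2 ∧ ∀ (g : G) (m n : ℕ), c ![g ^ m, g ^ n] = 0}
  zero_mem' := ⟨zero_mem _, fun _ _ _ => rfl⟩
  add_mem' := by
    rintro a b ⟨ha, ha'⟩ ⟨hb, hb'⟩
    exact ⟨add_mem ha hb, fun g m n => by simp [ha', hb']⟩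
  smul_mem' := by
    rintro r a ⟨ha, ha'⟩
    exact ⟨Submodule.smul_mem _ r ha, fun g m n => by simp [ha']⟩

theorem eq_zero_of_bdd_nat {t C : ℝ} (h : ∀ k : ℕ, |2 ^ k * t| ≤ C) : t = 0 := by
  by_contra ht
  have hp : 0 < |t| := abs_pos.mpr ht
  obtain ⟨k, hk⟩ := pow_unbounded_of_one_lt (C / |t|) (one_lt_two : (1 : ℝ) < 2)
  have h1 := h k
  rw [abs_mul, abs_of_pos (by positivity : (0 : ℝ) < 2 ^ k)] at h1
  rw [div_lt_iff₀ hp] at hk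
  linarith

/-- A bounded cocycle vanishing on the diagonal is homogeneous. -/
theorem homog_of_diag {G : Type*} [Group G] {c : (Fin 2 → G) → ℝ} (hc : c ∈ Zb G 2)
    (hd : ∀ g, c ![g, g] = 0) (g : G) (m n : ℕ) : c ![g ^ m, g ^ n] = 0 := by
  obtain ⟨C, hC⟩ := hc.1
  have hid := Zb_two_cocycle hc
  have h1 : c ![1, 1] = 0 := hd 1
  have h1r : ∀ x, c ![x, 1] = 0 := fun x => by
    have := hid x 1 1
    simp only [mul_one] at this
    linarith
  -- the fibre coordinate of the powers of the lift of `g` to the central extension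
  let e : ℕ → ℝ := fun k => ∑ i ∈ Finset.range k, c ![g ^ i, g]
  have he : ∀ i j, e (i + j) = e i + e j + c ![g ^ i, g ^ j] := by
    intro i j
    induction j with
    | zero => simp [e, h1r]
    | succ j ih =>
      have s1 : e (i + (j + 1)) = e (i + j) + c ![g ^ (i + j), g] := by
        simp only [e, ← add_assoc, Finset.sum_range_succ]
      have s2 : e (j + 1) = e j + c ![g ^ j, g] := by
        simp only [e, Finset.sum_range_succ]
      have s3 := hid (g ^ i) (g ^ j) g
      rw [← pow_add, ← pow_succ] at s3
      linarith
  have he2 : ∀ k i, e (2 ^ k * i) = 2 ^ k * e i := by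
    intro k i
    induction k with
    | zero => simp
    | succ k ih =>
      have : 2 ^ (k + 1) * i = 2 ^ k * i + 2 ^ k * i := by ring
      rw [this, he, hd, ih]
      ring
  refine eq_zero_of_bdd_nat (C := C) fun k => ?_
  have h2 : (2 : ℝ) ^ k * c ![g ^ m, g ^ n] = c ![g ^ (2 ^ k * m), g ^ (2 ^ k * n)] := by
    have a := he m n
    have b := he (2 ^ k * m) (2 ^ k * n)
    rw [← mul_add, he2, he2, he2] at b
    rw [a] at b
    linarith
  rw [h2]
  exact hC _

theorem exists_homog {G : Type*} [Group G] {c : (Fin 2 → G) → ℝ} (hc : c ∈ Zb G 2) :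
    ∃ c' ∈ ZbHom G, c - c' ∈ Bb G 2 := by
  obtain ⟨C, hC⟩ := hc.1
  let a : G → ℕ → ℝ := fun g n => (1 / 2) ^ n * (c ![g ^ 2 ^ n, g ^ 2 ^ n] / 2)
  have hab : ∀ g n, |a g n| ≤ (1 / 2) ^ n * (C / 2) := by
    intro g n
    simp only [a, abs_mul, abs_div, abs_pow]
    have := hC ![g ^ 2 ^ n, g ^ 2 ^ n]
    norm_num
    gcongr
  have hsC : Summable fun n : ℕ => (1 / 2 : ℝ) ^ n * (C / 2) :=
    summable_geometric_two.mul_right _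
  have hs : ∀ g, Summable (a g) := fun g =>
    Summable.of_norm_bounded hsC (fun n => by simpa using hab g n)
  let b : (Fin 1 → G) → ℝ := fun g => ∑' n, a (g 0) n
  have hb : b ∈ Cb G 1 := by
    refine ⟨∑' n : ℕ, (1 / 2 : ℝ) ^ n * (C / 2), fun g => ?_⟩
    exact tsum_of_norm_bounded (f := a (g 0)) hsC.hasSum (fun n => hab (g 0) n)
  have hdb : ∀ g : G, dR G 1 b ![g, g] = c ![g, g] := by
    intro g
    rw [dR_one_apply]
    have h1 : b ![g] = c ![g, g] / 2 + ∑' n, a g (n + 1) := by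
      have := (hs g).tsum_eq_zero_add
      simpa [b, a] using this
    have h2 : b ![g * g] = 2 * ∑' n, a g (n + 1) := by
      rw [← tsum_mul_left]
      simp only [b, Matrix.cons_val_zero]
      refine tsum_congr fun n => ?_
      have : (g * g) ^ 2 ^ n = g ^ 2 ^ (n + 1) := by
        rw [← pow_two, ← pow_mul, pow_succ']
      simp only [a, this, pow_succ]
      ring
    linarith
  have hZ : dR G 1 b ∈ Zb G 2 := by
    refine ⟨?_, inhomD_inhomD _ 1 b⟩
    obtain ⟨B, hB⟩ := hb
    refine ⟨B + B + B, fun g => ?_⟩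
    have hg : g = ![g 0, g 1] := by ext i; fin_cases i <;> rfl
    rw [hg, dR_one_apply]
    have x1 := abs_le.mp (hB ![g 1])
    have x2 := abs_le.mp (hB ![g 0 * g 1])
    have x3 := abs_le.mp (hB ![g 0])
    rw [abs_le]
    constructor <;> linarith
  have hZ' : c - dR G 1 b ∈ Zb G 2 := sub_mem hc hZ
  refine ⟨c - dR G 1 b, ⟨hZ', homog_of_diag hZ' fun g => ?_⟩, ?_⟩
  · simp [hdb]
  · rw [sub_sub_cancel]
    exact ⟨b, hb, rfl⟩

theorem homog_eq_zero {G : Type*} [Group G] {c : (Fin 2 → G) → ℝ} (hc : c ∈ ZbHom G)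
    (hB : c ∈ Bb G 2) : c = 0 := by
  obtain ⟨b, ⟨C, hC⟩, rfl⟩ := hB
  have h2 : ∀ g : G, b ![g * g] = 2 * b ![g] := fun g => by
    have := hc.2 g 1 1
    rw [pow_one, dR_one_apply] at this
    linarith
  have hk : ∀ (k : ℕ) (g : G), b ![g ^ 2 ^ k] = 2 ^ k * b ![g] := by
    intro k g
    induction k with
    | zero => simp
    | succ k ih =>
      rw [pow_succ, pow_mul, pow_two, h2, ih]
      ring
  have hb : b = 0 := by
    ext g
    have hg : g = ![g 0] := by ext i; fin_cases i; rfl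
    rw [hg]
    exact eq_zero_of_bdd_nat (C := C) fun k => by rw [← hk]; exact hC _
  rw [hb, map_zero]

/-- The class of a homogeneous bounded cocycle. -/
def homogClass (G : Type*) [Group G] : ZbHom G →ₗ[ℝ] Hb G 2 :=
  Hb.mk G 2 ∘ₗ Submodule.inclusion fun _ hc => hc.1

theorem homogClass_bijective (G : Type*) [Group G] : Function.Bijective (homogClass G) := by
  constructor
  · rw [injective_iff_map_eq_zero]
    intro c h
    have h' : (c : (Fin 2 → G) → ℝ) ∈ Bb G 2 :=
      (Submodule.Quotient.mk_eq_zero ((Bb G 2).comap (Zb G 2).subtype)).mp h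
    exact Subtype.ext (homog_eq_zero c.2 h')
  · intro x
    obtain ⟨⟨c, hc⟩, rfl⟩ := Submodule.mkQ_surjective _ x
    obtain ⟨c', hc', h⟩ := exists_homog hc
    refine ⟨⟨c', hc'⟩, Eq.symm ((Submodule.Quotient.eq _).mpr ?_)⟩
    exact h

/-- The unique homogeneous bounded cocycle `c_x` representing a class `x ∈ H_b²(G, ℝ)`. -/
noncomputable def homogRep (G : Type*) [Group G] : Hb G 2 ≃ₗ[ℝ] ZbHom G :=
  (LinearEquiv.ofBijective (homogClass G) (homogClass_bijective G)).symm

theorem homogRep_invariant {G Γ Q : Type*} [Group G] [Group Γ] [Group Q]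
    (S : GroupExtension G Γ Q) {x : Hb G 2} (hx : x ∈ Hb.invariants S 2) (γ : Γ) (g h : G) :
    (homogRep G x : (Fin 2 → G) → ℝ) ![S.conjAct γ g, S.conjAct γ h] =
      (homogRep G x : (Fin 2 → G) → ℝ) ![g, h] := by
  set c := homogRep G x with hcdef
  have hcx : homogClass G c = x :=
    (LinearEquiv.ofBijective (homogClass G) (homogClass_bijective G)).apply_symm_apply x
  let φ : G →* G := (S.conjAct γ).toMonoidHom
  have key : ∀ u v : G, pull φ 2 (c : (Fin 2 → G) → ℝ) ![u, v] =
      (c : (Fin 2 → G) → ℝ) ![S.conjAct γ u, S.conjAct γ v] := by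
    intro u v
    have e : (fun i => φ ((![u, v] : Fin 2 → G) i)) = ![S.conjAct γ u, S.conjAct γ v] := by
      ext i; fin_cases i <;> rfl
    exact congrArg (c : (Fin 2 → G) → ℝ) e
  have hmem : pull φ 2 (c : (Fin 2 → G) → ℝ) ∈ ZbHom G := by
    refine ⟨pull_mem_Zb φ 2 c.2.1, fun g m n => ?_⟩
    rw [key, map_pow, map_pow]
    exact c.2.2 _ m n
  have h1 : homogClass G ⟨_, hmem⟩ = homogClass G c := by
    rw [hcx]
    have h2 := hx γ
    rw [← hcx] at h2
    rw [← hcx]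
    exact h2
  have h3 := congrArg Subtype.val ((homogClass_bijective G).1 h1)
  rw [← key]
  exact congrFun h3 _

end Homogeneous

/-! ### The composition cocycle and the transgression operator -/

section Transgression

/-- The central extension `0 → ℝ → ℝ ×_c G → G → 1` defined by a homogeneous bounded `2`-cocycle
`c`: pairs `(t, g)` with `(t, g)(u, h) = (t + u + c(g, h), gh)`. The coordinate `t` is denoted
`phi`: it is the homogeneous quasi-morphism attached to the section `sec`, characterized by
`x = sec (proj x) * incl (phi x)`. -/
structure CentralExt {G : Type*} [Group G] (c : ZbHom G) where
  /-- the homogeneous quasi-morphism -/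
  phi : ℝ
  /-- the projection to `G` -/
  proj : G

namespace CentralExt

theorem ext' {G : Type*} [Group G] {c : ZbHom G} {x y : CentralExt c} (h1 : x.phi = y.phi)
    (h2 : x.proj = y.proj) : x = y := by
  cases x; cases y; simp_all

theorem c_one_left {G : Type*} [Group G] (c : ZbHom G) (g : G) : c.1 ![1, g] = 0 := by
  have := c.2.2 g 0 1
  simpa using this

theorem c_one_right {G : Type*} [Group G] (c : ZbHom G) (g : G) : c.1 ![g, 1] = 0 := by
  have := c.2.2 g 1 0
  simpa using this

instance {G : Type*} [Group G] (c : ZbHom G) : Mul (CentralExt c) :=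
  ⟨fun x y => ⟨x.phi + y.phi + c.1 ![x.proj, y.proj], x.proj * y.proj⟩⟩

instance {G : Type*} [Group G] (c : ZbHom G) : One (CentralExt c) := ⟨⟨0, 1⟩⟩

instance {G : Type*} [Group G] (c : ZbHom G) : Inv (CentralExt c) :=
  ⟨fun x => ⟨-x.phi - c.1 ![x.proj⁻¹, x.proj], x.proj⁻¹⟩⟩

theorem mul_phi {G : Type*} [Group G] {c : ZbHom G} (x y : CentralExt c) :
    (x * y).phi = x.phi + y.phi + c.1 ![x.proj, y.proj] := rfl

theorem mul_proj {G : Type*} [Group G] {c : ZbHom G} (x y : CentralExt c) :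
    (x * y).proj = x.proj * y.proj := rfl

theorem one_phi {G : Type*} [Group G] (c : ZbHom G) : (1 : CentralExt c).phi = 0 := rfl

theorem one_proj {G : Type*} [Group G] (c : ZbHom G) : (1 : CentralExt c).proj = 1 := rfl

theorem inv_phi {G : Type*} [Group G] {c : ZbHom G} (x : CentralExt c) :
    (x⁻¹).phi = -x.phi - c.1 ![x.proj⁻¹, x.proj] := rfl

theorem inv_proj {G : Type*} [Group G] {c : ZbHom G} (x : CentralExt c) :
    (x⁻¹).proj = x.proj⁻¹ := rfl

instance {G : Type*} [Group G] (c : ZbHom G) : Group (CentralExt c) :=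
  Group.ofLeftAxioms
    (fun x y z => by
      have h := Zb_two_cocycle c.2.1 x.proj y.proj z.proj
      refine ext' ?_ (mul_assoc _ _ _)
      simp only [mul_phi, mul_proj]
      linarith)
    (fun x => by
      refine ext' ?_ (one_mul _)
      simp [mul_phi, one_phi, one_proj, c_one_left])
    (fun x => by
      refine ext' ?_ (inv_mul_cancel _)
      simp only [mul_phi, one_phi, inv_phi, inv_proj]
      ring)

/-- The central inclusion `ℝ → ℝ ×_c G`. -/
def incl {G : Type*} [Group G] (c : ZbHom G) (t : ℝ) : CentralExt c := ⟨t, 1⟩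

/-- The section `s_x : G → ℝ ×_c G`, whose defect is `c`. -/
def sec {G : Type*} [Group G] (c : ZbHom G) (g : G) : CentralExt c := ⟨0, g⟩

end CentralExt

/-- An abstract kernel `(Ψ, f)` of the outer representation `θ : Π → Out(G)` of an extension
`1 → G → Γ → Π → 1`: a set-theoretic lift `Ψ : Π → Aut(G)` of `θ` (where `θ(σ(γ))` is the outer
class of the conjugation by `γ`) together with `f : Π × Π → G` such that
`Ψ(α) ∘ Ψ(β) = i_{f(α, β)} ∘ Ψ(αβ)`, `i_x` being the inner automorphism `g ↦ x g x⁻¹`. -/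
structure AbstractKernel {G Γ Q : Type*} [Group G] [Group Γ] [Group Q]
    (S : GroupExtension G Γ Q) where
  /-- the lift of the outer representation -/
  Psi : Q → MulAut G
  /-- the defect of the lift -/
  f : Q → Q → G
  lifts : ∀ γ : Γ, ∃ g : G, Psi (S.rightHom γ) = MulAut.conj g * S.conjAct γ
  comp : ∀ α β : Q, Psi α * Psi β = MulAut.conj (f α β) * Psi (α * β)

namespace AbstractKernel

open CentralExt

/-- The family of bijections `Ψ̄(α)(x) = s_x(Ψ(α)(p(x))) φ(x)` of the central extension. -/
def PsiBar {G Γ Q : Type*} [Group G] [Group Γ] [Group Q] {S : GroupExtension G Γ Q}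
    (N : AbstractKernel S) (c : ZbHom G) (α : Q) (x : CentralExt c) : CentralExt c :=
  sec c (N.Psi α x.proj) * incl c x.phi

/-- `F_x = s_x ∘ f`. -/
def FBar {G Γ Q : Type*} [Group G] [Group Γ] [Group Q] {S : GroupExtension G Γ Q}
    (N : AbstractKernel S) (c : ZbHom G) (α β : Q) : CentralExt c :=
  sec c (N.f α β)

/-- `K(α, β, γ) = Ψ̄(α)(F(β, γ)) F(α, βγ) F(αβ, γ)⁻¹ F(α, β)⁻¹` in the central extension. -/
def KBar {G Γ Q : Type*} [Group G] [Group Γ] [Group Q] {S : GroupExtension G Γ Q}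
    (N : AbstractKernel S) (c : ZbHom G) (α β γ : Q) : CentralExt c :=
  N.PsiBar c α (N.FBar c β γ) * N.FBar c α (β * γ) * (N.FBar c (α * β) γ)⁻¹ * (N.FBar c α β)⁻¹

/-- The composition cochain `φ_*(K) : Π³ → ℝ`. -/
def compCochain {G Γ Q : Type*} [Group G] [Group Γ] [Group Q] {S : GroupExtension G Γ Q}
    (N : AbstractKernel S) (c : ZbHom G) : (Fin 3 → Q) → ℝ :=
  fun a => (N.KBar c (a 0) (a 1) (a 2)).phi

end AbstractKernel

/-- Invariance of a cochain under the conjugation action of `Γ` on `G`. -/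
def ConjInvariant {G Γ Q : Type*} [Group G] [Group Γ] [Group Q] (S : GroupExtension G Γ Q)
    (c : ZbHom G) : Prop :=
  ∀ (γ : Γ) (g h : G), c.1 ![S.conjAct γ g, S.conjAct γ h] = c.1 ![g, h]

theorem conjAct_inl {G Γ Q : Type*} [Group G] [Group Γ] [Group Q] (S : GroupExtension G Γ Q)
    (k : G) : S.conjAct (S.inl k) = MulAut.conj k := by
  ext g
  apply S.inl_injective
  rw [S.inl_conjAct_comm]
  simp

namespace ConjInvariant

open CentralExt

theorem conj {G Γ Q : Type*} [Group G] [Group Γ] [Group Q] {S : GroupExtension G Γ Q}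
    {c : ZbHom G} (hc : ConjInvariant S c) (k g h : G) :
    c.1 ![k * g * k⁻¹, k * h * k⁻¹] = c.1 ![g, h] := by
  have := hc (S.inl k) g h
  rwa [conjAct_inl] at this

theorem psi {G Γ Q : Type*} [Group G] [Group Γ] [Group Q] {S : GroupExtension G Γ Q}
    {c : ZbHom G} (hc : ConjInvariant S c) (N : AbstractKernel S) (α : Q) (g h : G) :
    c.1 ![N.Psi α g, N.Psi α h] = c.1 ![g, h] := by
  obtain ⟨γ, rfl⟩ := S.rightHom_surjective α
  obtain ⟨k, hk⟩ := N.lifts γ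
  rw [hk]
  exact (hc.conj k _ _).trans (hc γ g h)

theorem symm_conj {G Γ Q : Type*} [Group G] [Group Γ] [Group Q] {S : GroupExtension G Γ Q}
    {c : ZbHom G} (hc : ConjInvariant S c) (k g : G) :
    c.1 ![k, g] = c.1 ![k * g * k⁻¹, k] := by
  let m : G → ℝ := fun g => c.1 ![k, g] - c.1 ![k * g * k⁻¹, k]
  have hm : ∀ g h, m (g * h) = m g + m h := by
    intro g h
    have e1 := Zb_two_cocycle c.2.1 k g h
    have e2 := Zb_two_cocycle c.2.1 (k * g * k⁻¹) (k * h * k⁻¹) k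
    have e3 := Zb_two_cocycle c.2.1 (k * g * k⁻¹) k h
    have e4 := hc.conj k g h
    have a1 : k * g * k⁻¹ * (k * h * k⁻¹) = k * (g * h) * k⁻¹ := by group
    have a2 : k * h * k⁻¹ * k = k * h := by group
    have a3 : k * g * k⁻¹ * k = k * g := by group
    rw [a1, a2] at e2
    rw [a3] at e3
    simp only [m]
    linarith
  have hk : ∀ (n : ℕ) (g : G), m (g ^ 2 ^ n) = 2 ^ n * m g := by
    intro n g
    induction n with
    | zero => simp
    | succ n ih =>
      rw [pow_succ, pow_mul, pow_two, hm, ih]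
      ring
  obtain ⟨C, hC⟩ := c.2.1.1
  have : m g = 0 := eq_zero_of_bdd_nat (C := C + C) fun n => by
    rw [← hk]
    exact (abs_sub _ _).trans (add_le_add (hC _) (hC _))
  exact sub_eq_zero.mp this

theorem pow_eq {G : Type*} [Group G] {c : ZbHom G} (x : CentralExt c) (n : ℕ) :
    x ^ n = ⟨n * x.phi, x.proj ^ n⟩ := by
  induction n with
  | zero => exact ext' (by simp [one_phi]) (by simp [one_proj])
  | succ n ih =>
    have := c.2.2 x.proj n 1
    rw [pow_one] at this
    rw [pow_succ, ih]
    refine ext' ?_ ?_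
    · simp only [mul_phi, this]
      push_cast
      ring
    · simp only [mul_proj, pow_succ]

theorem eq_zero_of_commute {G Γ Q : Type*} [Group G] [Group Γ] [Group Q]
    {S : GroupExtension G Γ Q} {c : ZbHom G} (hc : ConjInvariant S c) {g h : G}
    (hgh : g * h = h * g) : c.1 ![g, h] = 0 := by
  have hs : c.1 ![g, h] = c.1 ![h, g] := by
    rw [hc.symm_conj g h, hgh, mul_inv_cancel_right]
  have hcomm : Commute (sec c g) (sec c h) := by
    refine ext' ?_ hgh
    simp only [mul_phi, sec, hs]
  obtain ⟨C, hC⟩ := c.2.1.1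
  refine eq_zero_of_bdd_nat (C := C) fun k => ?_
  have h1 := congrArg CentralExt.phi (hcomm.mul_pow (2 ^ k))
  simp only [pow_eq, mul_phi, sec] at h1
  push_cast at h1
  have h2 : (2 : ℝ) ^ k * c.1 ![g, h] = c.1 ![g ^ 2 ^ k, h ^ 2 ^ k] := by linarith
  rw [h2]
  exact hC _

end ConjInvariant

theorem obstruction_cocycle {E Q : Type*} [Group E] [Group Q] (P : Q → E → E) (F : Q → Q → E)
    (K : Q → Q → Q → E) (hPm : ∀ α x y, P α (x * y) = P α x * P α y)
    (hP : ∀ α β x, P α (P β x) * F α β = F α β * P (α * β) x)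
    (hK : ∀ α β γ, P α (F β γ) * F α (β * γ) = K α β γ * (F α β * F (α * β) γ))
    (hKc : ∀ α β γ x, x * K α β γ = K α β γ * x) (α β γ ζ : Q) :
    P α (K β γ ζ) * K α (β * γ) ζ * K α β γ = K α β (γ * ζ) * K (α * β) γ ζ := by
  have L1 : P α (P β (F γ ζ) * F β (γ * ζ)) * F α (β * γ * ζ) =
      K α β (γ * ζ) * K (α * β) γ ζ * (F α β * F (α * β) γ * F (α * β * γ) ζ) := by
    rw [hPm, mul_assoc, mul_assoc β γ ζ, hK α β (γ * ζ), ← mul_assoc, hKc, mul_assoc,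
      ← mul_assoc (P α (P β (F γ ζ))), hP, mul_assoc (F α β), hK (α * β) γ ζ,
      ← mul_assoc (F α β), hKc]
    simp only [mul_assoc]
  have L2 : P α (P β (F γ ζ) * F β (γ * ζ)) * F α (β * γ * ζ) =
      P α (K β γ ζ) * K α (β * γ) ζ * K α β γ *
        (F α β * F (α * β) γ * F (α * β * γ) ζ) := by
    rw [hK β γ ζ, hPm, hPm, mul_assoc, mul_assoc (P α (F β γ)), hK α (β * γ) ζ,
      ← mul_assoc (P α (F β γ)), hKc, mul_assoc (K α (β * γ) ζ), ← mul_assoc (P α (F β γ)),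
      hK α β γ, ← mul_assoc α β γ]
    simp only [mul_assoc]
  exact mul_right_cancel (L2.symm.trans L1)

namespace AbstractKernel

open CentralExt

theorem psiBar_eq {G Γ Q : Type*} [Group G] [Group Γ] [Group Q] {S : GroupExtension G Γ Q}
    (N : AbstractKernel S) (c : ZbHom G) (α : Q) (x : CentralExt c) :
    N.PsiBar c α x = ⟨x.phi, N.Psi α x.proj⟩ := by
  refine ext' ?_ ?_
  · simp [PsiBar, mul_phi, sec, incl, c_one_right]
  · simp [PsiBar, mul_proj, sec, incl]

theorem kBar_mul {G Γ Q : Type*} [Group G] [Group Γ] [Group Q] {S : GroupExtension G Γ Q}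
    (N : AbstractKernel S) (c : ZbHom G) (α β γ : Q) :
    N.PsiBar c α (N.FBar c β γ) * N.FBar c α (β * γ) =
      N.KBar c α β γ * (N.FBar c α β * N.FBar c (α * β) γ) := by
  simp only [KBar]
  group

theorem kBar_proj_central {G Γ Q : Type*} [Group G] [Group Γ] [Group Q]
    {S : GroupExtension G Γ Q} (N : AbstractKernel S) (c : ZbHom G) (α β γ : Q) (g : G) :
    g * (N.KBar c α β γ).proj = (N.KBar c α β γ).proj * g := by
  have hproj : (N.KBar c α β γ).proj =
      N.Psi α (N.f β γ) * N.f α (β * γ) * (N.f (α * β) γ)⁻¹ * (N.f α β)⁻¹ := by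
    simp only [KBar, psiBar_eq, mul_proj, inv_proj, FBar, sec]
  have hconj : ∀ α β, MulAut.conj (N.f α β) = N.Psi α * N.Psi β * (N.Psi (α * β))⁻¹ :=
    fun α β => eq_mul_inv_of_mul_eq (N.comp α β).symm
  have hpsi : MulAut.conj (N.Psi α (N.f β γ)) =
      N.Psi α * MulAut.conj (N.f β γ) * (N.Psi α)⁻¹ := by
    ext x
    simp
  have h1 : MulAut.conj (N.KBar c α β γ).proj = 1 := by
    rw [hproj]
    simp only [map_mul, map_inv, hpsi, hconj, mul_assoc α β γ]
    group
  have h2 := congrArg (fun a : MulAut G => a g) h1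
  simp only [MulAut.conj_apply, MulAut.one_apply] at h2
  exact (mul_inv_eq_iff_eq_mul.mp h2).symm

theorem compCochain_apply {G Γ Q : Type*} [Group G] [Group Γ] [Group Q]
    {S : GroupExtension G Γ Q} (N : AbstractKernel S) {c : ZbHom G} (hc : ConjInvariant S c)
    (a : Fin 3 → Q) :
    N.compCochain c a = c.1 ![N.Psi (a 0) (N.f (a 1) (a 2)), N.f (a 0) (a 1 * a 2)] -
      c.1 ![N.f (a 0) (a 1), N.f (a 0 * a 1) (a 2)] := by
  have h := congrArg CentralExt.phi (N.kBar_mul c (a 0) (a 1) (a 2))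
  have h0 := hc.eq_zero_of_commute
    ((N.kBar_proj_central c (a 0) (a 1) (a 2) (N.f (a 0) (a 1) * N.f (a 0 * a 1) (a 2))).symm)
  rw [mul_phi (N.KBar c (a 0) (a 1) (a 2))] at h
  simp only [psiBar_eq, mul_phi, FBar, sec, mul_proj, h0] at h
  simp only [compCochain]
  linarith

theorem dR_three_apply {G : Type*} [Group G] (c : (Fin 3 → G) → ℝ) (x : Fin 4 → G) :
    dR G 3 c x = c ![x 1, x 2, x 3] - c ![x 0 * x 1, x 2, x 3] + c ![x 0, x 1 * x 2, x 3] -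
      c ![x 0, x 1, x 2 * x 3] + c ![x 0, x 1, x 2] := by
  have e0 : (fun i : Fin 3 => x i.succ) = ![x 1, x 2, x 3] := by
    ext i; fin_cases i <;> rfl
  have e1 : Fin.contractNth 0 (· * ·) x = ![x 0 * x 1, x 2, x 3] := by
    ext i; fin_cases i <;> rfl
  have e2 : Fin.contractNth 1 (· * ·) x = ![x 0, x 1 * x 2, x 3] := by
    ext i; fin_cases i <;> rfl
  have e3 : Fin.contractNth 2 (· * ·) x = ![x 0, x 1, x 2 * x 3] := by
    ext i; fin_cases i <;> rfl
  have e4 : Fin.contractNth 3 (· * ·) x = ![x 0, x 1, x 2] := by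
    ext i; fin_cases i <;> rfl
  change c (fun i : Fin 3 => x i.succ) + ∑ j : Fin 4,
    (-1 : ℝ) ^ ((j : ℕ) + 1) • c (Fin.contractNth j (· * ·) x) = _
  rw [Fin.sum_univ_four, e0, e1, e2, e3, e4]
  norm_num
  ring

theorem compCochain_mem {G Γ Q : Type*} [Group G] [Group Γ] [Group Q]
    {S : GroupExtension G Γ Q} (N : AbstractKernel S) {c : ZbHom G} (hc : ConjInvariant S c) :
    N.compCochain c ∈ Zb Q 3 := by
  refine ⟨?_, ?_⟩
  · obtain ⟨C, hC⟩ := c.2.1.1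
    refine ⟨C + C, fun a => ?_⟩
    rw [N.compCochain_apply hc]
    exact (abs_sub _ _).trans (add_le_add (hC _) (hC _))
  · have hKc : ∀ α β γ x, x * N.KBar c α β γ = N.KBar c α β γ * x := by
      intro α β γ x
      have h := N.kBar_proj_central c α β γ x.proj
      refine ext' ?_ h
      simp only [mul_phi, hc.eq_zero_of_commute h, hc.eq_zero_of_commute h.symm]
      ring
    change dR Q 3 (N.compCochain c) = 0
    ext x
    have h := congrArg CentralExt.phi (obstruction_cocycle (N.PsiBar c) (N.FBar c) (N.KBar c)
      (fun α x y => by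
        simp only [psiBar_eq]
        refine ext' ?_ ?_
        · simp only [mul_phi, hc.psi]
        · simp only [mul_proj, map_mul])
      (fun α β y => by
        have e := congrArg (fun a : MulAut G => a y.proj) (N.comp α β)
        simp only [MulAut.mul_apply, MulAut.conj_apply] at e
        simp only [psiBar_eq, FBar, sec]
        refine ext' ?_ ?_
        · simp only [mul_phi, e]
          rw [← hc.symm_conj]
          ring
        · simp only [mul_proj, e]
          group)
      (N.kBar_mul c) hKc (x 0) (x 1) (x 2) (x 3))
    have z1 : ∀ α β γ (y : CentralExt c),
        (y * N.KBar c α β γ).phi = y.phi + (N.KBar c α β γ).phi := by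
      intro α β γ y
      rw [mul_phi, hc.eq_zero_of_commute (N.kBar_proj_central c α β γ y.proj), add_zero]
    rw [z1, z1, z1, psiBar_eq] at h
    rw [dR_three_apply]
    change (N.KBar c (x 1) (x 2) (x 3)).phi - (N.KBar c (x 0 * x 1) (x 2) (x 3)).phi +
      (N.KBar c (x 0) (x 1 * x 2) (x 3)).phi - (N.KBar c (x 0) (x 1) (x 2 * x 3)).phi +
      (N.KBar c (x 0) (x 1) (x 2)).phi = 0
    simp only at h
    linarith

end AbstractKernel

theorem homogRep_conjInvariant {G Γ Q : Type*} [Group G] [Group Γ] [Group Q]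
    {S : GroupExtension G Γ Q} (x : Hb.invariants S 2) : ConjInvariant S (homogRep G x) :=
  fun γ g h => homogRep_invariant S x.2 γ g h

/-- The transgression operator `δ : H_b²(G, ℝ)^Π → H_b³(Π, ℝ)`, `δ(x) = [φ_*(K)]`, where the
composition cocycle `φ_*(K)` is built from the homogeneous cocycle `c_x` of `x` and an abstract
kernel of the outer representation. -/
noncomputable def transgression {G Γ Q : Type*} [Group G] [Group Γ] [Group Q]
    {S : GroupExtension G Γ Q} (N : AbstractKernel S) :
    Hb.invariants S 2 →ₗ[ℝ] Hb Q 3 where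
  toFun x := Hb.mk Q 3 ⟨N.compCochain (homogRep G x),
    N.compCochain_mem (homogRep_conjInvariant x)⟩
  map_add' x y := by
    rw [← map_add]
    congr 1
    ext a
    change N.compCochain (homogRep G (x + y : Hb.invariants S 2)) a =
      N.compCochain (homogRep G x) a + N.compCochain (homogRep G y) a
    rw [N.compCochain_apply (homogRep_conjInvariant x),
      N.compCochain_apply (homogRep_conjInvariant y),
      N.compCochain_apply (homogRep_conjInvariant (x + y))]
    simp only [Submodule.coe_add, map_add, Pi.add_apply]
    ring
  map_smul' r x := by
    rw [RingHom.id_apply, ← map_smul]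
    congr 1
    ext a
    change N.compCochain (homogRep G (r • x : Hb.invariants S 2)) a =
      r * N.compCochain (homogRep G x) a
    rw [N.compCochain_apply (homogRep_conjInvariant x),
      N.compCochain_apply (homogRep_conjInvariant (r • x))]
    simp only [Submodule.coe_smul, map_smul, Pi.smul_apply, smul_eq_mul]
    ring

end Transgression

/-! ### The spectral sequence of a filtered complex -/

section SpectralSequence

/-- A cochain complex of real vector spaces with a decreasing filtration, presented inside one
ambient space `A`: `gr n` is the space `Kⁿ`, `d` is the differential (of degree `+1`) and
`fil p ⊓ gr n` is `FᵖKⁿ`. -/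
structure FilteredComplex (A : Type*) [AddCommGroup A] [Module ℝ A] where
  d : A →ₗ[ℝ] A
  gr : ℤ → Submodule ℝ A
  fil : ℤ → Submodule ℝ A
  d_d : ∀ x, d (d x) = 0
  d_gr : ∀ n x, x ∈ gr n → d x ∈ gr (n + 1)
  fil_anti : Antitone fil
  fil_nonpos : ∀ p, p ≤ 0 → fil p = ⊤
  d_fil : ∀ p x, x ∈ fil p → d x ∈ fil p

namespace FilteredComplex

/-- `FᵖKⁿ`. -/
def FK {A : Type*} [AddCommGroup A] [Module ℝ A] (C : FilteredComplex A) (p n : ℤ) :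
    Submodule ℝ A := C.fil p ⊓ C.gr n

/-- `Z_r^{p,q} = {x ∈ FᵖK^{p+q} | d x ∈ F^{p+r}K^{p+q+1}}`. -/
def Z {A : Type*} [AddCommGroup A] [Module ℝ A] (C : FilteredComplex A) (r p q : ℤ) :
    Submodule ℝ A := C.FK p (p + q) ⊓ (C.FK (p + r) (p + q + 1)).comap C.d

/-- `B_r^{p,q} = {x ∈ FᵖK^{p+q} | ∃ y ∈ F^{p-r}K^{p+q-1}, d y = x}`. -/
def B {A : Type*} [AddCommGroup A] [Module ℝ A] (C : FilteredComplex A) (r p q : ℤ) :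
    Submodule ℝ A := C.FK p (p + q) ⊓ (C.FK (p - r) (p + q - 1)).map C.d

/-- `E_r^{p,q} = Z_r^{p,q} / (Z_{r-1}^{p+1,q-1} + B_{r-1}^{p,q})`. -/
abbrev E {A : Type*} [AddCommGroup A] [Module ℝ A] (C : FilteredComplex A) (r p q : ℤ) :
    Type _ :=
  C.Z r p q ⧸ (C.Z (r - 1) (p + 1) (q - 1) ⊔ C.B (r - 1) p q).comap (C.Z r p q).subtype

theorem d_mem_Z {A : Type*} [AddCommGroup A] [Module ℝ A] (C : FilteredComplex A)
    {r p q p' q' : ℤ} (hp : p + r = p') (hq : q - r + 1 = q') {x : A} (hx : x ∈ C.Z r p q) :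
    C.d x ∈ C.Z r p' q' := by
  subst hp hq
  have h := hx.2
  refine ⟨?_, ?_⟩
  · have e : p + r + (q - r + 1) = p + q + 1 := by ring
    rw [e]
    exact h
  · change C.d (C.d x) ∈ C.FK (p + r + r) (p + r + (q - r + 1) + 1)
    rw [C.d_d]
    exact zero_mem _

/-- The differential `d_r : E_r^{p,q} → E_r^{p+r,q-r+1}`, `[x] ↦ [d x]`. -/
def dr {A : Type*} [AddCommGroup A] [Module ℝ A] (C : FilteredComplex A)
    {r p q p' q' : ℤ} (hp : p + r = p') (hq : q - r + 1 = q') : C.E r p q →ₗ[ℝ] C.E r p' q' :=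
  Submodule.mapQ _ _ (C.d.restrict fun _ hx => C.d_mem_Z hp hq hx) (by
    subst hp hq
    rintro ⟨x, hx⟩ h
    have h' : x ∈ C.Z (r - 1) (p + 1) (q - 1) ⊔ C.B (r - 1) p q := h
    obtain ⟨y, hy, z, hz, rfl⟩ := Submodule.mem_sup.mp h'
    have hdz : C.d z = 0 := by
      obtain ⟨w, -, rfl⟩ := hz.2
      exact C.d_d w
    refine Submodule.mem_sup_right ?_
    change C.d (y + z) ∈ C.B (r - 1) (p + r) (q - r + 1)
    rw [map_add, hdz, add_zero]
    refine ⟨?_, y, ?_, rfl⟩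
    · have h2 := hy.2
      have e1 : p + 1 + (r - 1) = p + r := by ring
      have e2 : p + 1 + (q - 1) + 1 = p + r + (q - r + 1) := by ring
      rw [e1, e2] at h2
      exact h2
    · have h1 := hy.1
      have e1 : p + 1 = p + r - (r - 1) := by ring
      have e2 : p + 1 + (q - 1) = p + r + (q - r + 1) - 1 := by ring
      rw [e2, e1] at h1
      exact h1)

end FilteredComplex

end SpectralSequence

/-! ### The Hochschild–Serre double complex in bounded cohomology -/

section HochschildSerre

/-- `U^q = L_G(ℝ[Γ^{q+1}], ℝ)`: the bounded functions on `Γ^{q+1}` invariant under the diagonal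
left translations by `G`. -/
def UU {G Γ Q : Type*} [Group G] [Group Γ] [Group Q] (S : GroupExtension G Γ Q) (q : ℕ) :
    Submodule ℝ ((Fin (q + 1) → Γ) → ℝ) where
  carrier := {f | (∃ C : ℝ, ∀ x, |f x| ≤ C) ∧ ∀ (g : G) x, f (fun i => S.inl g * x i) = f x}
  zero_mem' := ⟨⟨0, by simp⟩, fun _ _ => rfl⟩
  add_mem' := by
    rintro f f' ⟨⟨C, hC⟩, h⟩ ⟨⟨C', hC'⟩, h'⟩
    exact ⟨⟨C + C', fun g => (abs_add_le _ _).trans (add_le_add (hC g) (hC' g))⟩,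
      fun g x => by simp [h, h']⟩
  smul_mem' := by
    rintro r f ⟨⟨C, hC⟩, h⟩
    refine ⟨⟨|r| * C, fun g => ?_⟩, fun g x => by simp [h]⟩
    simpa [abs_mul] using mul_le_mul_of_nonneg_left (hC g) (abs_nonneg r)

instance {G Γ Q : Type*} [Group G] [Group Γ] [Group Q] (S : GroupExtension G Γ Q) (q : ℕ) :
    AddCommGroup (UU S q) := Submodule.addCommGroup _

instance {G Γ Q : Type*} [Group G] [Group Γ] [Group Q] (S : GroupExtension G Γ Q) (q : ℕ) :
    Module ℝ (UU S q) := Submodule.module _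

/-- Translation `(γ • f)(x₀, …, x_q) = f(γ⁻¹x₀, …, γ⁻¹x_q)` on `U^q`. -/
def transl {G Γ Q : Type*} [Group G] [Group Γ] [Group Q] (S : GroupExtension G Γ Q) (q : ℕ)
    (γ : Γ) : UU S q →ₗ[ℝ] UU S q where
  toFun f := ⟨fun x => f.1 (fun i => γ⁻¹ * x i), by
    obtain ⟨C, hC⟩ := f.2.1
    refine ⟨⟨C, fun x => hC _⟩, fun g x => ?_⟩
    have h := f.2.2 (S.conjAct γ⁻¹ g) (fun i => γ⁻¹ * x i)
    simp only [S.inl_conjAct_comm, inv_inv, mul_assoc, mul_inv_cancel_left] at h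
    exact h⟩
  map_add' _ _ := rfl
  map_smul' _ _ := rfl

theorem transl_eq {G Γ Q : Type*} [Group G] [Group Γ] [Group Q] (S : GroupExtension G Γ Q)
    (q : ℕ) {γ γ' : Γ} (h : S.rightHom γ = S.rightHom γ') : transl S q γ = transl S q γ' := by
  have hk : γ'⁻¹ * γ ∈ S.inl.range := by
    rw [S.range_inl_eq_ker_rightHom, MonoidHom.mem_ker]
    simp [h]
  obtain ⟨g, hg⟩ := hk
  ext f x
  have h2 := f.2.2 g (fun i => γ⁻¹ * x i)
  rw [hg] at h2
  simp only [mul_assoc, mul_inv_cancel_left] at h2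
  exact h2.symm

/-- The action of `Π` on `U^q`: an element `α` acts as the translation by any of its lifts to
`Γ`. -/
noncomputable def rhoU {G Γ Q : Type*} [Group G] [Group Γ] [Group Q] (S : GroupExtension G Γ Q)
    (q : ℕ) : Representation ℝ Q (UU S q) where
  toFun α := transl S q (Function.surjInv S.rightHom_surjective α)
  map_one' := by
    rw [transl_eq S q (γ' := 1) (by
      rw [Function.surjInv_eq S.rightHom_surjective, map_one])]
    ext f x
    simp [transl]
  map_mul' α β := by
    rw [transl_eq S q (γ' := Function.surjInv S.rightHom_surjective α *
      Function.surjInv S.rightHom_surjective β) (by simp [Function.surjInv_eq])]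
    ext f x
    simp [transl, mul_assoc]

theorem rhoU_rightHom {G Γ Q : Type*} [Group G] [Group Γ] [Group Q] (S : GroupExtension G Γ Q)
    (q : ℕ) (γ : Γ) : rhoU S q (S.rightHom γ) = transl S q γ :=
  transl_eq S q (Function.surjInv_eq _ _)

theorem altD_bound {X : Type*} {n : ℕ} {f : (Fin (n + 1) → X) → ℝ} {C : ℝ}
    (h : ∀ x, |f x| ≤ C) (x : Fin (n + 2) → X) : |altD X ℝ n f x| ≤ (n + 2) * C := by
  change |∑ i : Fin (n + 2), (-1 : ℝ) ^ (i : ℕ) • f (fun j => x (i.succAbove j))| ≤ _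
  refine (Finset.abs_sum_le_sum_abs _ _).trans ?_
  have h1 : ∀ i ∈ (Finset.univ : Finset (Fin (n + 2))),
      |(-1 : ℝ) ^ (i : ℕ) • f (fun j => x (i.succAbove j))| ≤ C := fun i _ => by
    simpa [abs_mul] using h _
  refine (Finset.sum_le_sum h1).trans ?_
  simp

/-- The vertical differential `U^q → U^{q+1}`. -/
def dU {G Γ Q : Type*} [Group G] [Group Γ] [Group Q] (S : GroupExtension G Γ Q) (q : ℕ) :
    UU S q →ₗ[ℝ] UU S (q + 1) :=
  (altD Γ ℝ q).restrict (by
    rintro f ⟨⟨C, hC⟩, h⟩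
    refine ⟨⟨(q + 2) * C, altD_bound hC⟩, fun g x => ?_⟩
    simp only [altD, LinearMap.coe_mk, AddHom.coe_mk]
    exact Finset.sum_congr rfl fun i _ => by rw [h g (fun j => x (i.succAbove j))])

/-- `K^{p,q} = C_b^p(Π, U^q)`: the bounded inhomogeneous `p`-cochains on `Π` with values in
`U^q` (endowed with the supremum norm). -/
def KK {G Γ Q : Type*} [Group G] [Group Γ] [Group Q] (S : GroupExtension G Γ Q) (p q : ℕ) :
    Submodule ℝ ((Fin p → Q) → UU S q) where
  carrier := {f | ∃ C : ℝ, ∀ a x, |(f a).1 x| ≤ C}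
  zero_mem' := ⟨0, by simp⟩
  add_mem' := by
    rintro f f' ⟨C, hC⟩ ⟨C', hC'⟩
    exact ⟨C + C', fun g x => (abs_add_le _ _).trans (add_le_add (hC g x) (hC' g x))⟩
  smul_mem' := by
    rintro r f ⟨C, hC⟩
    refine ⟨|r| * C, fun g x => ?_⟩
    simpa [abs_mul] using mul_le_mul_of_nonneg_left (hC g x) (abs_nonneg r)

instance {G Γ Q : Type*} [Group G] [Group Γ] [Group Q] (S : GroupExtension G Γ Q) (p q : ℕ) :
    AddCommGroup (KK S p q) := Submodule.addCommGroup _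

instance {G Γ Q : Type*} [Group G] [Group Γ] [Group Q] (S : GroupExtension G Γ Q) (p q : ℕ) :
    Module ℝ (KK S p q) := Submodule.module _

/-- The horizontal differential `d_Π : K^{p,q} → K^{p+1,q}`. -/
noncomputable def dH {G Γ Q : Type*} [Group G] [Group Γ] [Group Q] (S : GroupExtension G Γ Q)
    (p q : ℕ) : KK S p q →ₗ[ℝ] KK S (p + 1) q :=
  (inhomD (rhoU S q) p).restrict (by
    rintro f ⟨C, hC⟩
    refine ⟨C + ∑ _j : Fin (p + 1), C, fun a x => ?_⟩
    have e : (inhomD (rhoU S q) p f a).1 x =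
        (f fun i => a i.succ).1
          (fun i => (Function.surjInv S.rightHom_surjective (a 0))⁻¹ * x i) +
        ∑ j : Fin (p + 1), (-1 : ℝ) ^ ((j : ℕ) + 1) *
          (f (Fin.contractNth j (· * ·) a)).1 x := by
      simp [inhomD, rhoU, transl]
    rw [e]
    refine (abs_add_le _ _).trans (add_le_add (hC _ _) ?_)
    refine (Finset.abs_sum_le_sum_abs _ _).trans (Finset.sum_le_sum fun j _ => ?_)
    simpa [abs_mul] using hC _ _)

/-- The vertical differential `d_U : K^{p,q} → K^{p,q+1}`. -/
def dV {G Γ Q : Type*} [Group G] [Group Γ] [Group Q] (S : GroupExtension G Γ Q)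
    (p q : ℕ) : KK S p q →ₗ[ℝ] KK S p (q + 1) :=
  ((dU S q).compLeft (Fin p → Q)).restrict (by
    rintro f ⟨C, hC⟩
    exact ⟨(q + 2) * C, fun a x => altD_bound (hC a) x⟩)

theorem dH_dH {G Γ Q : Type*} [Group G] [Group Γ] [Group Q] (S : GroupExtension G Γ Q)
    (p q : ℕ) (f : KK S p q) : dH S (p + 1) q (dH S p q f) = 0 :=
  Subtype.ext (inhomD_inhomD (rhoU S q) p f.1)

theorem dV_dV {G Γ Q : Type*} [Group G] [Group Γ] [Group Q] (S : GroupExtension G Γ Q)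
    (p q : ℕ) (f : KK S p q) : dV S p (q + 1) (dV S p q f) = 0 :=
  Subtype.ext (funext fun a => Subtype.ext (altD_altD q (f.1 a).1))

theorem dU_rhoU {G Γ Q : Type*} [Group G] [Group Γ] [Group Q] (S : GroupExtension G Γ Q)
    (q : ℕ) (α : Q) (u : UU S q) : dU S q (rhoU S q α u) = rhoU S (q + 1) α (dU S q u) := rfl

theorem dV_dH {G Γ Q : Type*} [Group G] [Group Γ] [Group Q] (S : GroupExtension G Γ Q)
    (p q : ℕ) (f : KK S p q) : dV S (p + 1) q (dH S p q f) = dH S p (q + 1) (dV S p q f) := by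
  refine Subtype.ext (funext fun a => ?_)
  change dU S q (inhomD (rhoU S q) p f.1 a) =
    inhomD (rhoU S (q + 1)) p (fun b => dU S q (f.1 b)) a
  simp only [inhomD, LinearMap.coe_mk, AddHom.coe_mk, map_add, map_sum, map_smul, dU_rhoU]

/-- Families of elements of the `K^{p,q}`; the elements of `Tot(K)ⁿ` are those supported on
`p + q = n`. -/
def TotFam {G Γ Q : Type*} [Group G] [Group Γ] [Group Q] (S : GroupExtension G Γ Q) :
    Type _ := (p q : ℕ) → KK S p q

noncomputable instance {G Γ Q : Type*} [Group G] [Group Γ] [Group Q]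
    (S : GroupExtension G Γ Q) : AddCommGroup (TotFam S) :=
  inferInstanceAs (AddCommGroup ((p q : ℕ) → KK S p q))

noncomputable instance {G Γ Q : Type*} [Group G] [Group Γ] [Group Q]
    (S : GroupExtension G Γ Q) : Module ℝ (TotFam S) :=
  inferInstanceAs (Module ℝ ((p q : ℕ) → KK S p q))

/-- The component `x^{p,q}` of a family. -/
def comp {G Γ Q : Type*} [Group G] [Group Γ] [Group Q] (S : GroupExtension G Γ Q) (p q : ℕ) :
    TotFam S →ₗ[ℝ] KK S p q where
  toFun x := x p q
  map_add' _ _ := rfl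
  map_smul' _ _ := rfl

/-- The family with prescribed components. -/
def ofComp {G Γ Q : Type*} [Group G] [Group Γ] [Group Q] (S : GroupExtension G Γ Q)
    (k : (p q : ℕ) → KK S p q) : TotFam S := k

theorem comp_ofComp {G Γ Q : Type*} [Group G] [Group Γ] [Group Q] (S : GroupExtension G Γ Q)
    (k : (p q : ℕ) → KK S p q) (p q : ℕ) : comp S p q (ofComp S k) = k p q := rfl

theorem TotFam.ext {G Γ Q : Type*} [Group G] [Group Γ] [Group Q] {S : GroupExtension G Γ Q}
    {x y : TotFam S} (h : ∀ p q, comp S p q x = comp S p q y) : x = y :=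
  funext fun p => funext fun q => h p q

/-- The component of bidegree `(p, q)` of `d_Π x`. -/
noncomputable def hPart {G Γ Q : Type*} [Group G] [Group Γ] [Group Q]
    (S : GroupExtension G Γ Q) : (p q : ℕ) → TotFam S →ₗ[ℝ] KK S p q
  | 0, _ => 0
  | p + 1, q => dH S p q ∘ₗ comp S p q

/-- The component of bidegree `(p, q)` of `d_U x`. -/
noncomputable def vPart {G Γ Q : Type*} [Group G] [Group Γ] [Group Q]
    (S : GroupExtension G Γ Q) : (p q : ℕ) → TotFam S →ₗ[ℝ] KK S p q
  | _, 0 => 0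
  | p, q + 1 => dV S p q ∘ₗ comp S p q

/-- The total differential `d_Π + (-1)ᵖ d_U`. -/
noncomputable def totD {G Γ Q : Type*} [Group G] [Group Γ] [Group Q]
    (S : GroupExtension G Γ Q) : TotFam S →ₗ[ℝ] TotFam S where
  toFun x := ofComp S fun p q => hPart S p q x + (-1 : ℝ) ^ p • vPart S p q x
  map_add' x y := TotFam.ext fun p q => by
    simp only [map_add, comp_ofComp, smul_add]
    exact add_add_add_comm _ _ _ _
  map_smul' r x := TotFam.ext fun p q => by
    simp only [map_smul, comp_ofComp, smul_add, smul_comm r, RingHom.id_apply]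

theorem totD_apply {G Γ Q : Type*} [Group G] [Group Γ] [Group Q]
    (S : GroupExtension G Γ Q) (x : TotFam S) (p q : ℕ) :
    comp S p q (totD S x) = hPart S p q x + (-1 : ℝ) ^ p • vPart S p q x := rfl

theorem hPart_succ {G Γ Q : Type*} [Group G] [Group Γ] [Group Q]
    (S : GroupExtension G Γ Q) (x : TotFam S) (p q : ℕ) :
    hPart S (p + 1) q x = dH S p q (comp S p q x) := rfl

theorem hPart_zero {G Γ Q : Type*} [Group G] [Group Γ] [Group Q]
    (S : GroupExtension G Γ Q) (x : TotFam S) (q : ℕ) : hPart S 0 q x = 0 := rfl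

theorem vPart_succ {G Γ Q : Type*} [Group G] [Group Γ] [Group Q]
    (S : GroupExtension G Γ Q) (x : TotFam S) (p q : ℕ) :
    vPart S p (q + 1) x = dV S p q (comp S p q x) := by
  cases p <;> rfl

theorem vPart_zero {G Γ Q : Type*} [Group G] [Group Γ] [Group Q]
    (S : GroupExtension G Γ Q) (x : TotFam S) (p : ℕ) : vPart S p 0 x = 0 := by
  cases p <;> rfl

theorem anticomm_aux {M N P : Type*} [AddCommGroup M] [AddCommGroup N] [AddCommGroup P]
    [Module ℝ M] [Module ℝ N] [Module ℝ P] (f : M →ₗ[ℝ] P) (g : N →ₗ[ℝ] P) (r : ℝ) {a b : M}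
    {a' b' : N} (h1 : f a = 0) (h2 : g b' = 0) (h3 : g a' = f b) :
    f (a + r • b) + (r * -1) • g (a' + (r * -1) • b') = 0 := by
  rw [map_add, map_add, map_smul, map_smul, h1, h2, h3]
  module

theorem totD_totD {G Γ Q : Type*} [Group G] [Group Γ] [Group Q]
    (S : GroupExtension G Γ Q) (x : TotFam S) : totD S (totD S x) = 0 := by
  refine TotFam.ext fun p q => ?_
  rw [totD_apply, map_zero]
  rcases p with _ | p <;> rcases q with _ | q
  · rw [hPart_zero, vPart_zero, smul_zero, add_zero]
  · rw [hPart_zero, vPart_succ, totD_apply, hPart_zero, zero_add, pow_zero, one_smul, one_smul,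
      zero_add]
    rcases q with _ | q
    · rw [vPart_zero, map_zero]
    · rw [vPart_succ, dV_dV]
  · rw [vPart_zero, smul_zero, add_zero, hPart_succ, totD_apply, vPart_zero, smul_zero, add_zero]
    rcases p with _ | p
    · rw [hPart_zero, map_zero]
    · rw [hPart_succ, dH_dH]
  · have h1 : dH S p (q + 1) (hPart S p (q + 1) x) = 0 := by
      rcases p with _ | p
      · rw [hPart_zero, map_zero]
      · rw [hPart_succ, dH_dH]
    have h2 : dV S (p + 1) q (vPart S (p + 1) q x) = 0 := by
      rcases q with _ | q
      · rw [vPart_zero, map_zero]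
      · rw [vPart_succ, dV_dV]
    rw [hPart_succ, vPart_succ, totD_apply, totD_apply, pow_succ]
    refine anticomm_aux (dH S p (q + 1)) (dV S (p + 1) q) _ h1 h2 ?_
    rw [hPart_succ, vPart_succ, dV_dH]

theorem hPart_eq_zero {G Γ Q : Type*} [Group G] [Group Γ] [Group Q]
    {S : GroupExtension G Γ Q} {x : TotFam S} {p q : ℕ}
    (h : ∀ p', p = p' + 1 → comp S p' q x = 0) : hPart S p q x = 0 := by
  rcases p with _ | p
  · exact hPart_zero S x q
  · rw [hPart_succ, h p rfl, map_zero]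

theorem vPart_eq_zero {G Γ Q : Type*} [Group G] [Group Γ] [Group Q]
    {S : GroupExtension G Γ Q} {x : TotFam S} {p q : ℕ}
    (h : ∀ q', q = q' + 1 → comp S p q' x = 0) : vPart S p q x = 0 := by
  rcases q with _ | q
  · exact vPart_zero S x p
  · rw [vPart_succ, h q rfl, map_zero]

/-- The families supported in a set of bidegrees. -/
def supportedOn {G Γ Q : Type*} [Group G] [Group Γ] [Group Q]
    (S : GroupExtension G Γ Q) (T : ℕ → ℕ → Prop) : Submodule ℝ (TotFam S) where
  carrier := {x | ∀ p q : ℕ, ¬T p q → comp S p q x = 0}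
  zero_mem' := fun p q _ => map_zero (comp S p q)
  add_mem' := fun {x y} hx hy p q h => by rw [map_add, hx p q h, hy p q h, add_zero]
  smul_mem' := fun r x hx p q h => by rw [map_smul, hx p q h, smul_zero]

theorem totD_supportedOn {G Γ Q : Type*} [Group G] [Group Γ] [Group Q]
    (S : GroupExtension G Γ Q) {T T' : ℕ → ℕ → Prop} (h1 : ∀ p q, T p q → T' (p + 1) q)
    (h2 : ∀ p q, T p q → T' p (q + 1)) {x : TotFam S} (hx : x ∈ supportedOn S T) :
    totD S x ∈ supportedOn S T' := by
  intro p q h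
  rw [totD_apply, hPart_eq_zero, vPart_eq_zero, smul_zero, add_zero]
  · rintro q rfl
    exact hx p q fun e => h (h2 p q e)
  · rintro p rfl
    exact hx p q fun e => h (h1 p q e)

/-- The total complex of the double complex `K^{p,q} = C_b^p(Π, U^q)` with the filtration
`FᵖTot(K) = ∑_{i ≥ p} K^{i,j}`. Its spectral sequence is the Hochschild–Serre spectral sequence
of the extension in real bounded cohomology. -/
noncomputable def hochschildSerre {G Γ Q : Type*} [Group G] [Group Γ] [Group Q]
    (S : GroupExtension G Γ Q) : FilteredComplex (TotFam S) where
  d := totD S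
  gr n := supportedOn S fun p q => (p : ℤ) + q = n
  fil m := supportedOn S fun p _ => m ≤ p
  d_d := totD_totD S
  d_gr n _ hx := totD_supportedOn S (fun p q h => by push_cast; linarith)
    (fun p q h => by push_cast; linarith) hx
  fil_anti _ _ hm _ hx p q h := hx p q fun h' => h (hm.trans h')
  fil_nonpos m hm := eq_top_iff.mpr fun _ _ p _ h =>
    absurd (hm.trans (Int.natCast_nonneg p)) h
  d_fil m _ hx := totD_supportedOn S (fun p q h => by push_cast; linarith) (fun p q h => h) hx

end HochschildSerre

/-! ### The two edge terms -/

section Edges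

/-- The constant functions inside `U⁰`. -/
def constU {G Γ Q : Type*} [Group G] [Group Γ] [Group Q] (S : GroupExtension G Γ Q) :
    ℝ →ₗ[ℝ] UU S 0 where
  toFun t := ⟨fun _ => t, ⟨|t|, fun _ => le_rfl⟩, fun _ _ => rfl⟩
  map_add' _ _ := rfl
  map_smul' _ _ := rfl

/-- A bounded real `p`-cochain on `Π` regarded as an element of `K^{p,0} = C_b^p(Π, U⁰)` through
the constant functions. -/
def constK {G Γ Q : Type*} [Group G] [Group Γ] [Group Q] (S : GroupExtension G Γ Q) (p : ℕ) :
    Cb Q p →ₗ[ℝ] KK S p 0 where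
  toFun f := ⟨fun a => constU S (f.1 a), by
    obtain ⟨C, hC⟩ := f.2
    exact ⟨C, fun a _ => hC a⟩⟩
  map_add' _ _ := rfl
  map_smul' _ _ := rfl

theorem dH_constK {G Γ Q : Type*} [Group G] [Group Γ] [Group Q] (S : GroupExtension G Γ Q)
    (p : ℕ) (f : Cb Q p) :
    ((dH S p 0 (constK S p f)).1 : (Fin (p + 1) → Q) → UU S 0) =
      fun a => constU S (dR Q p f.1 a) := by
  funext a
  change inhomD (rhoU S 0) p (fun b => constU S (f.1 b)) a = _
  simp only [inhomD, dR, LinearMap.coe_mk, AddHom.coe_mk, map_add, map_sum, map_smul,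
    Representation.trivial_apply]
  rfl

theorem dV_constK {G Γ Q : Type*} [Group G] [Group Γ] [Group Q] (S : GroupExtension G Γ Q)
    (p : ℕ) (f : Cb Q p) : dV S p 0 (constK S p f) = 0 := by
  refine Subtype.ext (funext fun a => Subtype.ext (funext fun x => ?_))
  change ∑ i : Fin 2, (-1 : ℝ) ^ (i : ℕ) • f.1 a = 0
  rw [Fin.sum_univ_two]
  simp

/-- The family whose only component is `k`, placed in bidegree `(p, q)`. -/
noncomputable def single {G Γ Q : Type*} [Group G] [Group Γ] [Group Q] (S : GroupExtension G Γ Q) (p q : ℕ) :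
    KK S p q →ₗ[ℝ] TotFam S :=
  { toFun := fun k => ofComp S (Pi.single p (Pi.single q k))
    map_add' := fun k k' => by rw [Pi.single_add, Pi.single_add]; rfl
    map_smul' := fun r k => by rw [Pi.single_smul, Pi.single_smul]; rfl }

theorem single_same {G Γ Q : Type*} [Group G] [Group Γ] [Group Q] (S : GroupExtension G Γ Q)
    (p q : ℕ) (k : KK S p q) : comp S p q (single S p q k) = k := by
  change (Pi.single p (Pi.single q k) : (p q : ℕ) → KK S p q) p q = k
  rw [Pi.single_eq_same, Pi.single_eq_same]

theorem single_ne {G Γ Q : Type*} [Group G] [Group Γ] [Group Q] (S : GroupExtension G Γ Q)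
    {p q p' q' : ℕ} (k : KK S p q) (h : ¬(p' = p ∧ q' = q)) :
    comp S p' q' (single S p q k) = 0 := by
  change (Pi.single p (Pi.single q k) : (p q : ℕ) → KK S p q) p' q' = 0
  by_cases hp : p' = p
  · subst hp
    have hq : q' ≠ q := fun e => h ⟨rfl, e⟩
    rw [Pi.single_eq_same, Pi.single_eq_of_ne hq]
  · rw [Pi.single_eq_of_ne hp, Pi.zero_apply]

theorem totD_single_constK {G Γ Q : Type*} [Group G] [Group Γ] [Group Q]
    (S : GroupExtension G Γ Q) (p : ℕ) (f : Cb Q p) :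
    totD S (single S p 0 (constK S p f)) = single S (p + 1) 0 (dH S p 0 (constK S p f)) := by
  refine TotFam.ext fun p' q' => ?_
  rw [totD_apply]
  have hv : vPart S p' q' (single S p 0 (constK S p f)) = 0 := by
    rcases q' with _ | q'
    · exact vPart_zero S _ _
    · rw [vPart_succ]
      by_cases h : p' = p ∧ q' = 0
      · obtain ⟨rfl, rfl⟩ := h
        rw [single_same, dV_constK]
      · rw [single_ne S _ h, map_zero]
  rw [hv, smul_zero, add_zero]
  rcases p' with _ | p'
  · rw [hPart_zero, single_ne S _ (by simp)]
  · rw [hPart_succ]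
    by_cases h : p' = p ∧ q' = 0
    · obtain ⟨rfl, rfl⟩ := h
      rw [single_same, single_same]
    · rw [single_ne S _ h, single_ne S _ (by simpa using h), map_zero]

theorem single_mem_FK {G Γ Q : Type*} [Group G] [Group Γ] [Group Q] (S : GroupExtension G Γ Q)
    {p q : ℕ} (k : KK S p q) {m n : ℤ} (hm : m ≤ p) (hn : (p : ℤ) + q = n) :
    single S p q k ∈ (hochschildSerre S).FK m n := by
  refine ⟨fun p' q' h => single_ne S k ?_, fun p' q' h => single_ne S k ?_⟩
  · rintro ⟨rfl, rfl⟩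
    exact h hm
  · rintro ⟨rfl, rfl⟩
    exact h hn

theorem infl_mem {G Γ Q : Type*} [Group G] [Group Γ] [Group Q] (S : GroupExtension G Γ Q)
    (z : Zb Q 3) :
    single S 3 0 (constK S 3 ⟨z.1, z.2.1⟩) ∈ (hochschildSerre S).Z 3 3 0 := by
  refine ⟨single_mem_FK S _ (by norm_num) (by norm_num), ?_⟩
  have h0 : dR Q 3 z.1 = 0 := z.2.2
  have h1 : dH S 3 0 (constK S 3 ⟨z.1, z.2.1⟩) = 0 := by
    refine Subtype.ext ?_
    rw [dH_constK, h0]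
    funext a
    exact map_zero (constU S)
  change totD S (single S 3 0 (constK S 3 ⟨z.1, z.2.1⟩)) ∈ (hochschildSerre S).FK (3 + 3) (3 + 0 + 1)
  rw [totD_single_constK, h1, map_zero]
  exact zero_mem _

/-- The canonical map `H_b³(Π, ℝ) → E₃^{3,0}` sending the class of a cocycle `z` to the class of
`z` regarded as a cochain with constant values in `K^{3,0} = C_b³(Π, U⁰)`. -/
noncomputable def inflation {G Γ Q : Type*} [Group G] [Group Γ] [Group Q]
    (S : GroupExtension G Γ Q) : Hb Q 3 →ₗ[ℝ] (hochschildSerre S).E 3 3 0 :=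
  Submodule.mapQ _ _
    ((single S 3 0 ∘ₗ constK S 3 ∘ₗ Submodule.inclusion inf_le_left).codRestrict _
      (infl_mem S)) (by
    rintro ⟨z, hz⟩ ⟨b, hb, hbz⟩
    change dR Q 2 b = z at hbz
    refine Submodule.mem_sup_right ?_
    refine ⟨single_mem_FK S _ (by norm_num) (by norm_num),
      single S 2 0 (constK S 2 ⟨b, hb⟩), single_mem_FK S _ (by norm_num) (by norm_num), ?_⟩
    have e : dH S 2 0 (constK S 2 ⟨b, hb⟩) = constK S 3 ⟨z, hz.1⟩ := by
      refine Subtype.ext ?_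
      rw [dH_constK, hbz]
      rfl
    change totD S (single S 2 0 (constK S 2 ⟨b, hb⟩)) = single S 3 0 (constK S 3 ⟨z, hz.1⟩)
    rw [totD_single_constK, e])

/-- Restriction of an element of `U^q` to `G`, as an inhomogeneous cochain:
`(g₁, …, g_q) ↦ f(1, g₁, g₁g₂, …, g₁⋯g_q)`. -/
def resU {G Γ Q : Type*} [Group G] [Group Γ] [Group Q] (S : GroupExtension G Γ Q) (q : ℕ) :
    UU S q →ₗ[ℝ] ((Fin q → G) → ℝ) where
  toFun f g := f.1 (fun i => S.inl (Fin.partialProd g i))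
  map_add' _ _ := rfl
  map_smul' _ _ := rfl

theorem resU_mem {G Γ Q : Type*} [Group G] [Group Γ] [Group Q] (S : GroupExtension G Γ Q)
    (q : ℕ) (u : UU S q) : resU S q u ∈ Cb G q := by
  obtain ⟨C, hC⟩ := u.2.1
  exact ⟨C, fun g => hC _⟩

theorem dR_resU {G Γ Q : Type*} [Group G] [Group Γ] [Group Q] (S : GroupExtension G Γ Q)
    (q : ℕ) (u : UU S q) : dR G q (resU S q u) = resU S (q + 1) (dU S q u) := by
  ext g
  rw [dR, inhomD_eq]
  change altD G ℝ q (toHom (Representation.trivial ℝ G ℝ) (resU S q u)) (Fin.partialProd g) =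
    altD Γ ℝ q u.1 (fun i => S.inl (Fin.partialProd g i))
  simp only [altD, LinearMap.coe_mk, AddHom.coe_mk]
  refine Finset.sum_congr rfl fun i _ => ?_
  congr 1
  set b : Fin (q + 1) → G := fun j => Fin.partialProd g (i.succAbove j) with hb
  have h1 := u.2.2 (b 0) (fun j => S.inl (Fin.partialProd
    (fun i : Fin q => (b i.castSucc)⁻¹ * b i.succ) j))
  have h2 := Fin.partialProd_left_inv b
  have h3 : (fun j => S.inl (b 0) * S.inl (Fin.partialProd
      (fun i : Fin q => (b i.castSucc)⁻¹ * b i.succ) j)) = fun j => S.inl (b j) := by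
    funext j
    rw [← map_mul]
    exact congrArg S.inl (congrFun h2 j)
  rw [h3] at h1
  simp only [toHom, Representation.trivial_apply]
  exact h1.symm

/-- The restriction to `G` of the component `x^{0,2} ∈ C_b⁰(Π, U²) = U²`. -/
noncomputable def restr {G Γ Q : Type*} [Group G] [Group Γ] [Group Q] (S : GroupExtension G Γ Q) :
    TotFam S →ₗ[ℝ] ((Fin 2 → G) → ℝ) where
  toFun x := resU S 2 ((comp S 0 2 x).1 Fin.elim0)
  map_add' _ _ := rfl
  map_smul' _ _ := rfl

theorem edge_mem {G Γ Q : Type*} [Group G] [Group Γ] [Group Q] (S : GroupExtension G Γ Q)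
    {x : TotFam S} (hx : x ∈ (hochschildSerre S).Z 3 0 2) :
    restr S x ∈ Zb G 2 := by
  refine ⟨resU_mem S 2 _, ?_⟩
  have h1 : comp S 0 3 (totD S x) = 0 := hx.2.1 0 3 (by norm_num)
  rw [totD_apply, hPart_zero, vPart_succ, zero_add, pow_zero, one_smul] at h1
  have h2 : dU S 2 ((comp S 0 2 x).1 Fin.elim0) = 0 :=
    congrFun (congrArg Subtype.val h1) Fin.elim0
  change dR G 2 (resU S 2 ((comp S 0 2 x).1 Fin.elim0)) = 0
  rw [dR_resU, h2, map_zero]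

theorem restr_mem_Bb {G Γ Q : Type*} [Group G] [Group Γ] [Group Q] (S : GroupExtension G Γ Q)
    {x : TotFam S} (hx : x ∈ (hochschildSerre S).Z (3 - 1) (0 + 1) (2 - 1) ⊔
      (hochschildSerre S).B (3 - 1) 0 2) : restr S x ∈ Bb G 2 := by
  obtain ⟨y, hy, z, hz, rfl⟩ := Submodule.mem_sup.mp hx
  obtain ⟨w, hw, hwz⟩ := hz.2
  have hy0 : comp S 0 2 y = 0 := hy.1.1 0 2 (by norm_num)
  have hz0 : comp S 0 2 z = dV S 0 1 (comp S 0 1 w) := by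
    have e : comp S 0 2 (totD S w) = comp S 0 2 z := congrArg (comp S 0 2) hwz
    rw [← e, totD_apply, hPart_zero, vPart_succ, zero_add, pow_zero, one_smul]
  have hr : restr S y = 0 := by
    change resU S 2 ((comp S 0 2 y).1 Fin.elim0) = 0
    rw [hy0]
    rfl
  have hs : restr S z = dR G 1 (resU S 1 ((comp S 0 1 w).1 Fin.elim0)) := by
    change resU S 2 ((comp S 0 2 z).1 Fin.elim0) = _
    rw [hz0, dR_resU]
    rfl
  rw [map_add, hr, hs, zero_add]
  exact ⟨_, resU_mem S 1 _, rfl⟩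

/-- The canonical map `E₃^{0,2} → H_b²(G, ℝ)` sending the class of
`x = (x^{0,2}, x^{1,1}, x^{2,0})` to the class of the restriction to `G` of
`x^{0,2} ∈ C_b⁰(Π, U²) = U²`. -/
noncomputable def edge {G Γ Q : Type*} [Group G] [Group Γ] [Group Q]
    (S : GroupExtension G Γ Q) : (hochschildSerre S).E 3 0 2 →ₗ[ℝ] Hb G 2 :=
  Submodule.mapQ _ _ ((restr S).restrict fun _ hx => edge_mem S hx)
    fun _ hx => restr_mem_Bb S hx

end Edges

end BddCoh

namespace BddCoh

/-! ### Cochain formulas in low degrees -/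

section LowDegree

/-! Everything rests on an explicit lift of an invariant class to the total complex whose total
coboundary is the composition cocycle on the nose.

A section `τ` of `σ` gives a `G`-equivariant retraction `y ↦ y τ(σ y)⁻¹` of `Γ` onto `G`. Let `c` be
the homogeneous cocycle of an invariant class. Pulling back its left-invariant form along this
retraction gives a vertical cocycle `A(τ)` in `U²`. Two sections give a prism `P(τ, τ')` in `U¹`
with coboundary `A(τ') - A(τ)`. Three give `T(τ, τ', τ'')` in `U⁰` with coboundary `P(τ, τ'') - P(τ,
τ') - P(τ', τ'')`. As `c` is itself conjugation invariant, translating `A` or `P` by `γ` amounts to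
letting `γ` act on the sections. Homogeneity enters through `c(k, g) = c(k g k⁻¹, k)`, which makes
`P(τ, mτ)` vanish for `m` in `G`.

Choose a section `t` with `Ψ(α)` equal to conjugation by `t(α)`. The cochain with components `A(t)`,
`P(t, t(α)t)` and `T(t, t(α)t, t(α)t(β)t) - T(t, t(αβ)t, t(α)t(β)t)` restricts to `c`. Its total
coboundary has no component outside `K^{3,0}`. The value of its last component at `y` is minus the
composition cochain at `(α, β, (αβ)⁻¹σ(y))`, so the cocycle identity of `φ ∘ K` shows that the
remaining coboundary is `φ ∘ K`, with constant values (`dH_simplexK`, `totD_totCochain`). This gives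
both the surjectivity of `ι` and the formula for `d₃`.

What is left concerns low vertical degrees. The restriction from `U²` to `G` is injective on
cohomology (`exists_dU_eq_of_resU_mem`), hence `ι` is injective; it takes invariant values because
`d_Π x^{0,2} = d_U x^{1,1}` (`pull_resU_sub_mem`). The map `κ` is bijective because vertical
cohomology is the constants in degree zero and vanishes in degree one, a bounded homomorphism to `ℝ`
being zero (`exists_constK_eq`, `exists_dV_eq`). -/

theorem altD_zero_apply {X V : Type*} [AddCommGroup V] [Module ℝ V] (f : (Fin 1 → X) → V)
    (x : Fin 2 → X) : altD X V 0 f x = f ![x 1] - f ![x 0] := by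
  have e0 : (fun j : Fin 1 => x ((0 : Fin 2).succAbove j)) = ![x 1] := by
    ext i; fin_cases i; rfl
  have e1 : (fun j : Fin 1 => x ((1 : Fin 2).succAbove j)) = ![x 0] := by
    ext i; fin_cases i; rfl
  change ∑ i : Fin 2, (-1 : ℝ) ^ (i : ℕ) • f (fun j => x (i.succAbove j)) = _
  rw [Fin.sum_univ_two, e0, e1]
  simp [sub_eq_add_neg]

theorem altD_one_apply {X V : Type*} [AddCommGroup V] [Module ℝ V] (f : (Fin 2 → X) → V)
    (x : Fin 3 → X) :
    altD X V 1 f x = f ![x 1, x 2] - f ![x 0, x 2] + f ![x 0, x 1] := by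
  have e0 : (fun j : Fin 2 => x ((0 : Fin 3).succAbove j)) = ![x 1, x 2] := by
    ext i; fin_cases i <;> rfl
  have e1 : (fun j : Fin 2 => x ((1 : Fin 3).succAbove j)) = ![x 0, x 2] := by
    ext i; fin_cases i <;> rfl
  have e2 : (fun j : Fin 2 => x ((2 : Fin 3).succAbove j)) = ![x 0, x 1] := by
    ext i; fin_cases i <;> rfl
  change ∑ i : Fin 3, (-1 : ℝ) ^ (i : ℕ) • f (fun j => x (i.succAbove j)) = _
  rw [Fin.sum_univ_three, e0, e1, e2]
  simp [sub_eq_add_neg]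

theorem altD_two_apply {X V : Type*} [AddCommGroup V] [Module ℝ V] (f : (Fin 3 → X) → V)
    (x : Fin 4 → X) : altD X V 2 f x = f ![x 1, x 2, x 3] - f ![x 0, x 2, x 3] +
      f ![x 0, x 1, x 3] - f ![x 0, x 1, x 2] := by
  have e0 : (fun j : Fin 3 => x ((0 : Fin 4).succAbove j)) = ![x 1, x 2, x 3] := by
    ext i; fin_cases i <;> rfl
  have e1 : (fun j : Fin 3 => x ((1 : Fin 4).succAbove j)) = ![x 0, x 2, x 3] := by
    ext i; fin_cases i <;> rfl
  have e2 : (fun j : Fin 3 => x ((2 : Fin 4).succAbove j)) = ![x 0, x 1, x 3] := by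
    ext i; fin_cases i <;> rfl
  have e3 : (fun j : Fin 3 => x ((3 : Fin 4).succAbove j)) = ![x 0, x 1, x 2] := by
    ext i; fin_cases i <;> rfl
  change ∑ i : Fin 4, (-1 : ℝ) ^ (i : ℕ) • f (fun j => x (i.succAbove j)) = _
  rw [Fin.sum_univ_four, e0, e1, e2, e3]
  simp [pow_succ, sub_eq_add_neg]

theorem inhomD_zero_apply {G V : Type*} [Group G] [AddCommGroup V] [Module ℝ V]
    (ρ : Representation ℝ G V) (f : (Fin 0 → G) → V) (x : Fin 1 → G) :
    inhomD ρ 0 f x = ρ (x 0) (f Fin.elim0) - f Fin.elim0 := by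
  change ρ (x 0) (f fun i => x i.succ) + ∑ j : Fin 1,
    (-1 : ℝ) ^ ((j : ℕ) + 1) • f (Fin.contractNth j (· * ·) x) = _
  rw [Fin.sum_univ_one, Subsingleton.elim (fun i : Fin 0 => x i.succ) Fin.elim0,
    Subsingleton.elim (Fin.contractNth 0 (· * ·) x) Fin.elim0]
  simp [sub_eq_add_neg]

theorem inhomD_one_apply {G V : Type*} [Group G] [AddCommGroup V] [Module ℝ V]
    (ρ : Representation ℝ G V) (f : (Fin 1 → G) → V) (x : Fin 2 → G) :
    inhomD ρ 1 f x = ρ (x 0) (f ![x 1]) - f ![x 0 * x 1] + f ![x 0] := by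
  have e0 : (fun i : Fin 1 => x i.succ) = ![x 1] := by
    ext i; fin_cases i; rfl
  have e1 : Fin.contractNth 0 (· * ·) x = ![x 0 * x 1] := by
    ext i; fin_cases i; rfl
  have e2 : Fin.contractNth 1 (· * ·) x = ![x 0] := by
    ext i; fin_cases i; rfl
  change ρ (x 0) (f fun i => x i.succ) + ∑ j : Fin 2,
    (-1 : ℝ) ^ ((j : ℕ) + 1) • f (Fin.contractNth j (· * ·) x) = _
  rw [Fin.sum_univ_two, e0, e1, e2]
  simp [sub_eq_add_neg, add_assoc]

theorem inhomD_two_apply {G V : Type*} [Group G] [AddCommGroup V] [Module ℝ V]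
    (ρ : Representation ℝ G V) (f : (Fin 2 → G) → V) (x : Fin 3 → G) :
    inhomD ρ 2 f x = ρ (x 0) (f ![x 1, x 2]) - f ![x 0 * x 1, x 2] + f ![x 0, x 1 * x 2] -
      f ![x 0, x 1] := by
  have e0 : (fun i : Fin 2 => x i.succ) = ![x 1, x 2] := by
    ext i; fin_cases i <;> rfl
  have e1 : Fin.contractNth 0 (· * ·) x = ![x 0 * x 1, x 2] := by
    ext i; fin_cases i <;> rfl
  have e2 : Fin.contractNth 1 (· * ·) x = ![x 0, x 1 * x 2] := by
    ext i; fin_cases i <;> rfl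
  have e3 : Fin.contractNth 2 (· * ·) x = ![x 0, x 1] := by
    ext i; fin_cases i <;> rfl
  change ρ (x 0) (f fun i => x i.succ) + ∑ j : Fin 3,
    (-1 : ℝ) ^ ((j : ℕ) + 1) • f (Fin.contractNth j (· * ·) x) = _
  rw [Fin.sum_univ_three, e0, e1, e2, e3]
  simp [pow_succ, sub_eq_add_neg, add_assoc]

theorem altD_two_eq {X : Type*} {c : (Fin 3 → X) → ℝ} (hc : altD X ℝ 2 c = 0)
    (x y z w : X) : c ![y, z, w] - c ![x, z, w] + c ![x, y, w] - c ![x, y, z] = 0 := by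
  have h := congrFun hc ![x, y, z, w]
  rwa [altD_two_apply] at h

/-- The prism operator of two maps `a, b : Y → X`. -/
def prism {X Y : Type*} (c : (Fin 3 → X) → ℝ) (a b : Y → X) : (Fin 2 → Y) → ℝ :=
  fun y => c ![a (y 0), b (y 0), b (y 1)] - c ![a (y 0), a (y 1), b (y 1)]

/-- The prism over an edge is cut into two triangles; the identity is the sum of the cocycle
relation over the three tetrahedra triangulating the prism over a triangle. -/
theorem altD_prism {X Y : Type*} {c : (Fin 3 → X) → ℝ} (hc : altD X ℝ 2 c = 0) (a b : Y → X)
    (y : Fin 3 → Y) : altD Y ℝ 1 (prism c a b) y =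
      c (fun i => b (y i)) - c (fun i => a (y i)) := by
  have ea : (fun i => a (y i)) = ![a (y 0), a (y 1), a (y 2)] := by
    ext i; fin_cases i <;> rfl
  have eb : (fun i => b (y i)) = ![b (y 0), b (y 1), b (y 2)] := by
    ext i; fin_cases i <;> rfl
  rw [altD_one_apply, ea, eb]
  simp only [prism, Matrix.cons_val_zero, Matrix.cons_val_one]
  linarith [altD_two_eq hc (a (y 0)) (b (y 0)) (b (y 1)) (b (y 2)),
    altD_two_eq hc (a (y 0)) (a (y 1)) (b (y 1)) (b (y 2)),
    altD_two_eq hc (a (y 0)) (a (y 1)) (a (y 2)) (b (y 2))]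

/-- Prisms compose only up to a coboundary: the defect is the difference of the values on the
triangle `(a, b, e)` at the two ends of the edge. -/
theorem prism_add_prism {X Y : Type*} {c : (Fin 3 → X) → ℝ} (hc : altD X ℝ 2 c = 0)
    (a b e : Y → X) (y : Fin 2 → Y) :
    prism c a b y + prism c b e y - prism c a e y =
      c ![a (y 0), b (y 0), e (y 0)] - c ![a (y 1), b (y 1), e (y 1)] := by
  simp only [prism]
  linarith [altD_two_eq hc (a (y 0)) (b (y 0)) (e (y 0)) (e (y 1)),
    altD_two_eq hc (a (y 0)) (b (y 0)) (b (y 1)) (e (y 1)),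
    altD_two_eq hc (a (y 0)) (a (y 1)) (b (y 1)) (e (y 1))]

theorem prism_bound {X Y : Type*} {c : (Fin 3 → X) → ℝ} {C : ℝ} (hC : ∀ x, |c x| ≤ C)
    (a b : Y → X) (y : Fin 2 → Y) : |prism c a b y| ≤ C + C :=
  (abs_sub _ _).trans (add_le_add (hC _) (hC _))

/-- The homogeneous form of an inhomogeneous cocycle is a cocycle. -/
theorem altD_toHom_eq_zero {G : Type*} [Group G] {n : ℕ} {c : (Fin n → G) → ℝ}
    (hc : dR G n c = 0) :
    altD G ℝ n (toHom (Representation.trivial ℝ G ℝ) c) = 0 := by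
  rw [← toHom_inhomD]
  change toHom _ (dR G n c) = 0
  rw [hc]
  rfl

theorem toHom_trivial_two {G : Type*} [Group G] (c : (Fin 2 → G) → ℝ) (a b e : G) :
    toHom (Representation.trivial ℝ G ℝ) c ![a, b, e] = c ![a⁻¹ * b, b⁻¹ * e] := by
  change c _ = _
  congr 1
  ext i; fin_cases i <;> rfl

theorem toHom_trivial_mul_left {G : Type*} [Group G] {n : ℕ} (c : (Fin n → G) → ℝ) (g : G)
    (x : Fin (n + 1) → G) : toHom (Representation.trivial ℝ G ℝ) c (fun i => g * x i) =
      toHom (Representation.trivial ℝ G ℝ) c x := by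
  simp [toHom, mul_assoc]

end LowDegree

/-! ### Retractions onto the kernel of an extension -/

section Retractions

/-- The `G`-equivariant map `Γ → G`, `y ↦ y τ(σ(y))⁻¹`, attached to a section `τ` of `σ`. -/
noncomputable def retr {G Γ Q : Type*} [Group G] [Group Γ] [Group Q] (S : GroupExtension G Γ Q)
    (τ : S.Section) (y : Γ) : G :=
  Function.invFun S.inl (y * (τ (S.rightHom y))⁻¹)

theorem inl_retr {G Γ Q : Type*} [Group G] [Group Γ] [Group Q] (S : GroupExtension G Γ Q)
    (τ : S.Section) (y : Γ) : S.inl (retr S τ y) = y * (τ (S.rightHom y))⁻¹ := by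
  refine Function.invFun_eq (f := S.inl) ?_
  have h : y * (τ (S.rightHom y))⁻¹ ∈ S.inl.range := by
    rw [S.range_inl_eq_ker_rightHom, MonoidHom.mem_ker]
    simp
  exact h

/-- The retraction gives the unique `G`-coordinate of `y` relative to the section; every later
formula for it comes from this uniqueness. -/
theorem retr_eq {G Γ Q : Type*} [Group G] [Group Γ] [Group Q] (S : GroupExtension G Γ Q)
    {τ : S.Section} {y : Γ} {g : G} (h : S.inl g * τ (S.rightHom y) = y) : retr S τ y = g :=
  S.inl_injective (by rw [inl_retr, ← eq_mul_inv_of_mul_eq h])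

theorem retr_inl_mul {G Γ Q : Type*} [Group G] [Group Γ] [Group Q] (S : GroupExtension G Γ Q)
    (τ : S.Section) (g : G) (y : Γ) : retr S τ (S.inl g * y) = g * retr S τ y := by
  refine retr_eq S ?_
  rw [map_mul, map_mul, inl_retr, S.rightHom_inl, one_mul]
  group

/-- The translate `η ↦ γ τ(σ(γ)⁻¹ η)` of a section `τ`. -/
def shift {G Γ Q : Type*} [Group G] [Group Γ] [Group Q] (S : GroupExtension G Γ Q)
    (γ : Γ) (τ : S.Section) : S.Section :=
  ⟨fun η => γ * τ ((S.rightHom γ)⁻¹ * η), fun η => by simp⟩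

theorem shift_apply {G Γ Q : Type*} [Group G] [Group Γ] [Group Q] (S : GroupExtension G Γ Q)
    (γ : Γ) (τ : S.Section) (η : Q) : shift S γ τ η = γ * τ ((S.rightHom γ)⁻¹ * η) := rfl

theorem shift_mul {G Γ Q : Type*} [Group G] [Group Γ] [Group Q] (S : GroupExtension G Γ Q)
    (γ γ' : Γ) (τ : S.Section) : shift S (γ * γ') τ = shift S γ (shift S γ' τ) := by
  refine DFunLike.ext _ _ fun η => ?_
  simp only [shift_apply, map_mul, mul_inv_rev, mul_assoc]

/-- Translating the section conjugates the retraction, so translations of cochains can be traded for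
shifts of sections as soon as the cocycle is conjugation invariant. -/
theorem retr_shift {G Γ Q : Type*} [Group G] [Group Γ] [Group Q] (S : GroupExtension G Γ Q)
    (γ : Γ) (τ : S.Section) (y : Γ) :
    retr S (shift S γ τ) y = S.conjAct γ (retr S τ (γ⁻¹ * y)) := by
  refine retr_eq S ?_
  rw [S.inl_conjAct_comm, inl_retr, shift_apply, map_mul, map_inv]
  group

theorem retr_shift_inl {G Γ Q : Type*} [Group G] [Group Γ] [Group Q] (S : GroupExtension G Γ Q)
    (m : G) (τ : S.Section) (y : Γ) :
    retr S (shift S (S.inl m) τ) y = retr S τ y * m⁻¹ := by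
  refine retr_eq S ?_
  rw [shift_apply, map_mul, inl_retr, S.rightHom_inl, map_inv]
  simp

end Retractions

/-! ### The cochains attached to an invariant homogeneous cocycle and sections -/

section SectionCochains

/-- The left-invariant homogeneous form of a homogeneous `2`-cocycle. -/
def homogForm {G : Type*} [Group G] (c : ZbHom G) : (Fin 3 → G) → ℝ :=
  toHom (Representation.trivial ℝ G ℝ) c.1

theorem homogForm_apply {G : Type*} [Group G] (c : ZbHom G) (a b e : G) :
    homogForm c ![a, b, e] = c.1 ![a⁻¹ * b, b⁻¹ * e] := toHom_trivial_two c.1 a b e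

theorem altD_homogForm {G : Type*} [Group G] (c : ZbHom G) : altD G ℝ 2 (homogForm c) = 0 :=
  altD_toHom_eq_zero c.2.1.2

theorem homogForm_bounded {G : Type*} [Group G] (c : ZbHom G) :
    ∃ C, ∀ x, |homogForm c x| ≤ C := by
  obtain ⟨C, hC⟩ := c.2.1.1
  exact ⟨C, fun x => hC _⟩

/-- Once `c(x, x⁻¹) = 0`, the cocycle identity at `(h, g, g⁻¹)` and at `(h g, g⁻¹, h⁻¹)` expresses
`c(h g, g⁻¹)` in two ways. -/
theorem homog_inv {G : Type*} [Group G] (c : ZbHom G) (g h : G) :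
    c.1 ![g⁻¹, h⁻¹] = -c.1 ![h, g] := by
  have e1 := Zb_two_cocycle c.2.1 h g g⁻¹
  have e2 := Zb_two_cocycle c.2.1 (h * g) g⁻¹ h⁻¹
  -- Homogeneity is assumed for natural exponents only, so inverses need an argument: `c(x, x⁻¹)` is
  -- multiplied by `2 ^ k` when `x` is replaced by its `2 ^ k`-th power, yet stays bounded.
  have hz : ∀ x : G, c.1 ![x, x⁻¹] = 0 := by
    intro x
    obtain ⟨C, hC⟩ := c.2.1.1
    refine eq_zero_of_bdd_nat (C := C) fun k => ?_
    -- The lift of `x⁻¹` differs from the inverse of the lift of `x` by a central factor, so the two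
    -- lifts commute and powers distribute over their product.
    have hcomm : Commute (CentralExt.sec c x) (CentralExt.sec c x⁻¹) := by
      have e : CentralExt.sec c x⁻¹ =
          (CentralExt.sec c x)⁻¹ * CentralExt.incl c (c.1 ![x⁻¹, x]) := by
        refine CentralExt.ext' ?_ ?_
        · simp [CentralExt.mul_phi, CentralExt.inv_phi, CentralExt.inv_proj, CentralExt.sec,
            CentralExt.incl, CentralExt.c_one_right]
        · simp [CentralExt.mul_proj, CentralExt.inv_proj, CentralExt.sec, CentralExt.incl]
      rw [e]
      refine Commute.mul_right (Commute.inv_right (Commute.refl _)) ?_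
      refine CentralExt.ext' ?_ ?_
      · simp [CentralExt.mul_phi, CentralExt.sec, CentralExt.incl, CentralExt.c_one_left,
          CentralExt.c_one_right]
      · simp [CentralExt.mul_proj, CentralExt.sec, CentralExt.incl]
    have h3 := congrArg CentralExt.phi (hcomm.mul_pow (2 ^ k))
    simp only [ConjInvariant.pow_eq, CentralExt.mul_phi, CentralExt.sec] at h3
    push_cast at h3
    have h4 : (2 : ℝ) ^ k * c.1 ![x, x⁻¹] = c.1 ![x ^ 2 ^ k, x⁻¹ ^ 2 ^ k] := by linarith
    rw [h4]
    exact hC _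
  have h5 := hz (h * g)
  have h6 : c.1 ![h * g * g⁻¹, h⁻¹] = 0 := by rw [mul_inv_cancel_right]; exact hz h
  rw [hz, mul_inv_cancel, CentralExt.c_one_right] at e1
  rw [h6, ← mul_inv_rev, h5] at e2
  linarith

theorem ConjInvariant.form_conjAct {G Γ Q : Type*} [Group G] [Group Γ] [Group Q]
    {S : GroupExtension G Γ Q} {c : ZbHom G} (hc : ConjInvariant S c) (γ : Γ) (a b e : G) :
    homogForm c ![S.conjAct γ a, S.conjAct γ b, S.conjAct γ e] = homogForm c ![a, b, e] := by
  simp only [homogForm_apply, ← map_inv, ← map_mul]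
  exact hc γ _ _

/-- The prism vanishes between a map to `G` and its translate on the right by a constant. -/
theorem ConjInvariant.prism_mul_right {G Γ Q Y : Type*} [Group G] [Group Γ] [Group Q]
    {S : GroupExtension G Γ Q} {c : ZbHom G} (hc : ConjInvariant S c) (a : Y → G) (m : G)
    (y : Fin 2 → Y) : prism (homogForm c) a (fun y => a y * m) y = 0 := by
  simp only [prism, homogForm_apply]
  -- With `u = (a (y 0))⁻¹ a (y 1)` the prism is `c(m, m⁻¹ u m) - c(u, m)`, which is the symmetry of
  -- `c` under conjugation by `m`.
  have h := hc.symm_conj m (m⁻¹ * ((a (y 0))⁻¹ * a (y 1)) * m)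
  have e : m * (m⁻¹ * ((a (y 0))⁻¹ * a (y 1)) * m) * m⁻¹ = (a (y 0))⁻¹ * a (y 1) := by group
  rw [e] at h
  have e1 : (a (y 0))⁻¹ * (a (y 0) * m) = m := by group
  have e2 : (a (y 1))⁻¹ * (a (y 1) * m) = m := by group
  have e3 : (a (y 0) * m)⁻¹ * (a (y 1) * m) = m⁻¹ * ((a (y 0))⁻¹ * a (y 1)) * m := by group
  rw [e1, e2, e3, h, sub_self]

variable {G Γ Q : Type*} [Group G] [Group Γ] [Group Q] (S : GroupExtension G Γ Q) (c : ZbHom G)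

/-- The pull-back to `U²` of a cocycle along the equivariant map attached to a section. -/
noncomputable def cocycleU (τ : S.Section) : UU S 2 :=
  ⟨fun y => homogForm c ![retr S τ (y 0), retr S τ (y 1), retr S τ (y 2)], by
    obtain ⟨C, hC⟩ := homogForm_bounded c
    refine ⟨⟨C, fun y => hC _⟩, fun g y => ?_⟩
    simp only [retr_inl_mul, homogForm_apply]
    group⟩

/-- The prism in `U¹` between the pull-backs attached to two sections. -/
noncomputable def prismU (τ τ' : S.Section) : UU S 1 :=
  ⟨prism (homogForm c) (retr S τ) (retr S τ'), by
    obtain ⟨C, hC⟩ := homogForm_bounded c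
    refine ⟨⟨C + C, prism_bound hC _ _⟩, fun g y => ?_⟩
    simp only [prism, retr_inl_mul, homogForm_apply]
    group⟩

/-- The element of `U⁰` attached to three sections. -/
noncomputable def simplexU (τ τ' τ'' : S.Section) : UU S 0 :=
  ⟨fun y => homogForm c ![retr S τ (y 0), retr S τ' (y 0), retr S τ'' (y 0)], by
    obtain ⟨C, hC⟩ := homogForm_bounded c
    refine ⟨⟨C, fun y => hC _⟩, fun g y => ?_⟩
    simp only [retr_inl_mul, homogForm_apply]
    group⟩

theorem dU_cocycleU (τ : S.Section) : dU S 2 (cocycleU S c τ) = 0 := by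
  refine Subtype.ext (funext fun y => ?_)
  change altD Γ ℝ 2 (cocycleU S c τ).1 y = 0
  rw [altD_two_apply]
  exact altD_two_eq (altD_homogForm c) _ _ _ _

theorem dU_prismU (τ τ' : S.Section) :
    dU S 1 (prismU S c τ τ') = cocycleU S c τ' - cocycleU S c τ := by
  refine Subtype.ext (funext fun y => ?_)
  refine (altD_prism (altD_homogForm c) (retr S τ) (retr S τ') y).trans ?_
  refine congrArg₂ (· - ·) (congrArg (homogForm c) ?_) (congrArg (homogForm c) ?_) <;>
  · ext i; fin_cases i <;> rfl

theorem dU_simplexU (τ τ' τ'' : S.Section) :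
    dU S 0 (simplexU S c τ τ' τ'') =
      prismU S c τ τ'' - prismU S c τ τ' - prismU S c τ' τ'' := by
  refine Subtype.ext (funext fun y => ?_)
  change altD Γ ℝ 0 (simplexU S c τ τ' τ'').1 y = prism (homogForm c) (retr S τ) (retr S τ'') y -
    prism (homogForm c) (retr S τ) (retr S τ') y - prism (homogForm c) (retr S τ') (retr S τ'') y
  rw [altD_zero_apply]
  change homogForm c ![retr S τ (y 1), retr S τ' (y 1), retr S τ'' (y 1)] -
    homogForm c ![retr S τ (y 0), retr S τ' (y 0), retr S τ'' (y 0)] = _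
  linarith [prism_add_prism (altD_homogForm c) (retr S τ) (retr S τ') (retr S τ'') y]

variable {S c}

/-- The conjugation produced by shifting the section is absorbed by the invariance of `c`. Here it
is the cocycle, not merely its class, that must be invariant. -/
theorem transl_cocycleU (hc : ConjInvariant S c) (γ : Γ) (τ : S.Section) :
    transl S 2 γ (cocycleU S c τ) = cocycleU S c (shift S γ τ) := by
  refine Subtype.ext (funext fun y => ?_)
  simp only [transl, cocycleU, LinearMap.coe_mk, AddHom.coe_mk, retr_shift, hc.form_conjAct]

theorem transl_prismU (hc : ConjInvariant S c) (γ : Γ) (τ τ' : S.Section) :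
    transl S 1 γ (prismU S c τ τ') = prismU S c (shift S γ τ) (shift S γ τ') := by
  refine Subtype.ext (funext fun y => ?_)
  simp only [transl, prismU, prism, LinearMap.coe_mk, AddHom.coe_mk, retr_shift, hc.form_conjAct]

/-- Shifting a section by an element of `G` multiplies its retraction on the right by a constant.
This makes the failure of `t` to be multiplicative invisible to prisms. -/
theorem prismU_shift_inl (hc : ConjInvariant S c) (m : G) (τ : S.Section) :
    prismU S c τ (shift S (S.inl m) τ) = 0 := by
  refine Subtype.ext (funext fun y => ?_)
  have e : retr S (shift S (S.inl m) τ) = fun y => retr S τ y * m⁻¹ :=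
    funext (retr_shift_inl S m τ)
  change prism (homogForm c) (retr S τ) (retr S (shift S (S.inl m) τ)) y = 0
  rw [e, hc.prism_mul_right]

/-- On `G` the retraction is right multiplication by its value at `1`, which need not be trivial
since `τ` is not normalized. The restriction is thus a conjugate of `c`, equal to `c` by invariance.
-/
theorem resU_cocycleU (hc : ConjInvariant S c) (τ : S.Section) :
    resU S 2 (cocycleU S c τ) = c.1 := by
  ext g
  have hr : ∀ u : G, retr S τ (S.inl u) = u * retr S τ 1 := fun u => by
    rw [← retr_inl_mul, mul_one]
  have h0 : Fin.partialProd g 0 = 1 := Fin.partialProd_zero g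
  have h1 : Fin.partialProd g 1 = g 0 := by
    simpa using Fin.partialProd_succ g 0
  have h2 : Fin.partialProd g 2 = g 0 * g 1 := by
    have := Fin.partialProd_succ g 1
    simpa [h1] using this
  change homogForm c ![retr S τ (S.inl (Fin.partialProd g 0)),
    retr S τ (S.inl (Fin.partialProd g 1)),
    retr S τ (S.inl (Fin.partialProd g 2))] = c.1 g
  rw [hr, hr, hr, h0, h1, h2, homogForm_apply]
  have h := hc.conj (retr S τ 1)⁻¹ (g 0) (g 1)
  have e1 : (1 * retr S τ 1)⁻¹ * (g 0 * retr S τ 1) =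
    (retr S τ 1)⁻¹ * g 0 * (retr S τ 1)⁻¹⁻¹ := by group
  have e2 : (g 0 * retr S τ 1)⁻¹ * (g 0 * g 1 * retr S τ 1) =
    (retr S τ 1)⁻¹ * g 1 * (retr S τ 1)⁻¹⁻¹ := by group
  rw [e1, e2, h]
  refine congrArg c.1 ?_
  ext i; fin_cases i <;> rfl

/-- The retraction is inverse to the section, so the steps `g`, `h` between sections become right
multiplications by `g⁻¹`, `h⁻¹`; `homog_inv` reverses the order and produces the sign. -/
theorem simplexU_apply {τ τ' τ'' : S.Section} {y : Fin 1 → Γ} {g h : G}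
    (hg : τ' (S.rightHom (y 0)) = S.inl g * τ (S.rightHom (y 0)))
    (hh : τ'' (S.rightHom (y 0)) = S.inl h * τ' (S.rightHom (y 0))) :
    (simplexU S c τ τ' τ'').1 y = -c.1 ![h, g] := by
  have e1 : retr S τ' (y 0) = retr S τ (y 0) * g⁻¹ := by
    refine retr_eq S ?_
    rw [map_mul, inl_retr, map_inv, hg]
    group
  have e2 : retr S τ'' (y 0) = retr S τ' (y 0) * h⁻¹ := by
    refine retr_eq S ?_
    rw [map_mul, inl_retr, map_inv, hh]
    group
  change homogForm c ![retr S τ (y 0), retr S τ' (y 0), retr S τ'' (y 0)] = _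
  rw [homogForm_apply, e2, e1, inv_mul_cancel_left, inv_mul_cancel_left, homog_inv]

end SectionCochains

/-! ### The cocycle of the total complex attached to an invariant class -/

section TransgressionCochain

open CentralExt

/-- Invariant homogeneous cocycles vanish on commuting pairs, so two of the four terms of the
cocycle identity at `(g, h, z)` drop out. -/
theorem ConjInvariant.mul_central_right {G Γ Q : Type*} [Group G] [Group Γ] [Group Q]
    {S : GroupExtension G Γ Q} {c : ZbHom G} (hc : ConjInvariant S c) {z : G}
    (hz : ∀ g, g * z = z * g) (g h : G) : c.1 ![g, h * z] = c.1 ![g, h] := by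
  have := Zb_two_cocycle c.2.1 g h z
  rw [hc.eq_zero_of_commute (hz (g * h)), hc.eq_zero_of_commute (hz h)] at this
  linarith

theorem ConjInvariant.mul_central_left {G Γ Q : Type*} [Group G] [Group Γ] [Group Q]
    {S : GroupExtension G Γ Q} {c : ZbHom G} (hc : ConjInvariant S c) {z : G}
    (hz : ∀ g, g * z = z * g) (g h : G) : c.1 ![g * z, h] = c.1 ![g, h] := by
  have := Zb_two_cocycle c.2.1 g z h
  rw [hc.eq_zero_of_commute (hz g), hc.eq_zero_of_commute (hz h).symm, ← hz h,
    hc.mul_central_right hz] at this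
  linarith

/-- The values of an invariant cocycle only depend on inner automorphisms. -/
theorem ConjInvariant.congr_conj {G Γ Q : Type*} [Group G] [Group Γ] [Group Q]
    {S : GroupExtension G Γ Q} {c : ZbHom G} (hc : ConjInvariant S c) {g g' h h' : G}
    (hg : MulAut.conj g = MulAut.conj g') (hh : MulAut.conj h = MulAut.conj h') :
    c.1 ![g, h] = c.1 ![g', h'] := by
  -- Elements inducing the same inner automorphism differ by a central factor.
  have key : ∀ {a b : G}, MulAut.conj a = MulAut.conj b → ∀ x, x * (b⁻¹ * a) = b⁻¹ * a * x := by
    intro a b hab x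
    have h1 := congrArg (fun e : MulAut G => e x) hab
    simp only [MulAut.conj_apply] at h1
    have h2 : a * x = b * x * b⁻¹ * a := by rw [← h1]; group
    rw [mul_assoc b⁻¹, h2]
    group
  rw [← mul_inv_cancel_left g' g, ← mul_inv_cancel_left h' h, hc.mul_central_left (key hg),
    hc.mul_central_right (key hh)]

/-- The inner automorphism separating `Ψ(σ(γ))` from conjugation by `γ` is absorbed by multiplying
`γ` by an element of `G`. The defect of the resulting section agrees with `N.f` only up to the
centre. -/
theorem AbstractKernel.exists_section {G Γ Q : Type*} [Group G] [Group Γ] [Group Q]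
    {S : GroupExtension G Γ Q} (N : AbstractKernel S) :
    ∃ t : S.Section, ∀ α, N.Psi α = S.conjAct (t α) := by
  have h : ∀ α, ∃ γ : Γ, S.rightHom γ = α ∧ N.Psi α = S.conjAct γ := by
    intro α
    obtain ⟨γ, rfl⟩ := S.rightHom_surjective α
    obtain ⟨g, hg⟩ := N.lifts γ
    exact ⟨S.inl g * γ, by simp, by rw [hg, map_mul, conjAct_inl]⟩
  choose t ht htp using h
  exact ⟨⟨t, ht⟩, htp⟩

theorem exists_defect {G Γ Q : Type*} [Group G] [Group Γ] [Group Q]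
    {S : GroupExtension G Γ Q} (t : S.Section) :
    ∃ F : Q → Q → G, ∀ α β, t α * t β = S.inl (F α β) * t (α * β) := by
  refine ⟨fun α β => retr S t (t α * t β), fun α β => ?_⟩
  rw [inl_retr, map_mul, t.rightHom_section, t.rightHom_section, inv_mul_cancel_right]

/-- The composition cochain may be computed from the defect of a section of the extension. -/
theorem AbstractKernel.compCochain_eq {G Γ Q : Type*} [Group G] [Group Γ] [Group Q]
    {S : GroupExtension G Γ Q} (N : AbstractKernel S) {c : ZbHom G} (hc : ConjInvariant S c)
    {t : S.Section} (ht : ∀ α, N.Psi α = S.conjAct (t α)) {F : Q → Q → G}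
    (hF : ∀ α β, t α * t β = S.inl (F α β) * t (α * β)) (a : Fin 3 → Q) :
    N.compCochain c a = c.1 ![S.conjAct (t (a 0)) (F (a 1) (a 2)), F (a 0) (a 1 * a 2)] -
      c.1 ![F (a 0) (a 1), F (a 0 * a 1) (a 2)] := by
  -- Both `N.f` and `F` measure the defect of `Ψ`, hence induce the same inner automorphisms; this
  -- suffices for `c`.
  have hf : ∀ α β, MulAut.conj (N.f α β) = MulAut.conj (F α β) := by
    intro α β
    have h := N.comp α β
    rw [ht, ht, ht, ← map_mul, hF, map_mul, conjAct_inl] at h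
    exact (mul_right_cancel h).symm
  have hpsi : ∀ (e : MulAut G) (x : G), MulAut.conj (e x) = e * MulAut.conj x * e⁻¹ := by
    intro e x
    ext y
    simp
  rw [N.compCochain_apply hc, ht]
  refine congrArg₂ (· - ·) (hc.congr_conj ?_ (hf _ _)) (hc.congr_conj (hf _ _) (hf _ _))
  rw [hpsi, hpsi, hf]

theorem rhoU_section {G Γ Q : Type*} [Group G] [Group Γ] [Group Q] (S : GroupExtension G Γ Q)
    (q : ℕ) (t : S.Section) (α : Q) : rhoU S q α = transl S q (t α) := by
  rw [← rhoU_rightHom, t.rightHom_section]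

theorem totD_single {G Γ Q : Type*} [Group G] [Group Γ] [Group Q]
    (S : GroupExtension G Γ Q) (p q : ℕ) (k : KK S p q) :
    totD S (single S p q k) =
      single S (p + 1) q (dH S p q k) + (-1 : ℝ) ^ p • single S p (q + 1) (dV S p q k) := by
  refine TotFam.ext fun p' q' => ?_
  rw [totD_apply, map_add, map_smul]
  congr 1
  · rcases p' with _ | p'
    · rw [hPart_zero, single_ne S _ (by simp)]
    · rw [hPart_succ]
      by_cases h : p' = p ∧ q' = q
      · obtain ⟨rfl, rfl⟩ := h
        rw [single_same, single_same]
      · rw [single_ne S _ h, single_ne S _ (by simpa using h), map_zero]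
  · rcases q' with _ | q'
    · rw [vPart_zero, single_ne S _ (by simp), smul_zero, smul_zero]
    · rw [vPart_succ]
      by_cases h : p' = p ∧ q' = q
      · obtain ⟨rfl, rfl⟩ := h
        rw [single_same, single_same]
      · rw [single_ne S _ h, single_ne S _ (by simpa using h), map_zero, smul_zero, smul_zero]

variable {G Γ Q : Type*} [Group G] [Group Γ] [Group Q] (S : GroupExtension G Γ Q) (c : ZbHom G)

/-- The component in `K^{0,2}`. -/
noncomputable def cocycleK (t : S.Section) : KK S 0 2 :=
  ⟨fun _ => cocycleU S c t, by
    obtain ⟨C, hC⟩ := (cocycleU S c t).2.1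
    exact ⟨C, fun _ => hC⟩⟩

/-- The component in `K^{1,1}`. -/
noncomputable def prismK (t : S.Section) : KK S 1 1 :=
  ⟨fun a => prismU S c t (shift S (t (a 0)) t), by
    obtain ⟨C, hC⟩ := homogForm_bounded c
    exact ⟨C + C, fun a => prism_bound hC _ _⟩⟩

/-- The component in `K^{2,0}`. -/
noncomputable def simplexK (t : S.Section) : KK S 2 0 :=
  ⟨fun a => simplexU S c t (shift S (t (a 0)) t) (shift S (t (a 0) * t (a 1)) t) -
      simplexU S c t (shift S (t (a 0 * a 1)) t) (shift S (t (a 0) * t (a 1)) t), by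
    obtain ⟨C, hC⟩ := homogForm_bounded c
    exact ⟨C + C, fun a x => (abs_sub _ _).trans (add_le_add (hC _) (hC _))⟩⟩

/-- An element of `Tot²` whose component in `K^{0,2}` extends the invariant cocycle `c`. -/
noncomputable def totCochain (t : S.Section) : TotFam S :=
  single S 0 2 (cocycleK S c t) + single S 1 1 (prismK S c t) + single S 2 0 (simplexK S c t)

variable {S c}

theorem dV_cocycleK (t : S.Section) : dV S 0 2 (cocycleK S c t) = 0 :=
  Subtype.ext (funext fun _ => dU_cocycleU S c t)

theorem dH_cocycleK (hc : ConjInvariant S c) (t : S.Section) :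
    dH S 0 2 (cocycleK S c t) = dV S 1 1 (prismK S c t) := by
  refine Subtype.ext (funext fun a => ?_)
  refine (inhomD_zero_apply (rhoU S 2) (cocycleK S c t).1 a).trans ?_
  rw [rhoU_section S 2 t]
  exact (congrArg (· - _) (transl_cocycleU hc _ _)).trans (dU_prismU S c _ _).symm

/-- The horizontal coboundary is `P(t(α)t, t(α)t(β)t) - P(t, t(αβ)t) + P(t, t(α)t)`. Its last
vertices `t(α)t(β)t` and `t(αβ)t` differ by a shift by `G`, so two triangles are needed to fill it.
-/
theorem dH_prismK (hc : ConjInvariant S c) (t : S.Section) :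
    dH S 1 1 (prismK S c t) = -dV S 2 0 (simplexK S c t) := by
  obtain ⟨F, hF⟩ := exists_defect t
  refine Subtype.ext (funext fun a => ?_)
  refine (inhomD_one_apply (rhoU S 1) (prismK S c t).1 a).trans ?_
  rw [rhoU_section S 1 t]
  change transl S 1 (t (a 0)) (prismU S c t (shift S (t (a 1)) t)) -
      prismU S c t (shift S (t (a 0 * a 1)) t) + prismU S c t (shift S (t (a 0)) t) =
    -dU S 0 (simplexU S c t (shift S (t (a 0)) t) (shift S (t (a 0) * t (a 1)) t) -
      simplexU S c t (shift S (t (a 0 * a 1)) t) (shift S (t (a 0) * t (a 1)) t))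
  -- This is the vanishing of `P(t(αβ)t, t(α)t(β)t)`, the edge introduced by the second triangle.
  have h := prismU_shift_inl hc (F (a 0) (a 1)) (shift S (t (a 0 * a 1)) t)
  rw [← shift_mul, ← hF] at h
  rw [transl_prismU hc, ← shift_mul, map_sub, dU_simplexU, dU_simplexU, h]
  abel

/-- The two triangles correspond to the two ways of reducing `t(α) t(β) t(ω)`, with `ω =
(αβ)⁻¹σ(y)`, to an element of `G` times `t(σ(y))`. Comparing them gives the two terms of the
composition cochain. -/
theorem simplexK_apply {t : S.Section} {F : Q → Q → G}
    (hF : ∀ α β, t α * t β = S.inl (F α β) * t (α * β)) (a : Fin 2 → Q) (y : Fin 1 → Γ) :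
    ((simplexK S c t).1 a).1 y =
      c.1 ![F (a 0) (a 1), F (a 0 * a 1) ((a 0 * a 1)⁻¹ * S.rightHom (y 0))] -
      c.1 ![S.conjAct (t (a 0)) (F (a 1) ((a 0 * a 1)⁻¹ * S.rightHom (y 0))),
        F (a 0) (a 1 * ((a 0 * a 1)⁻¹ * S.rightHom (y 0)))] := by
  set α := a 0
  set β := a 1
  set η := S.rightHom (y 0)
  set ω := (α * β)⁻¹ * η with hω
  have hη : α * (β * ω) = η := by rw [hω]; group
  have hη' : α⁻¹ * η = β * ω := by rw [hω]; group
  have s1 : ∀ γ : Γ, S.rightHom γ = α * β → shift S γ t η = γ * t ω := by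
    intro γ h
    rw [shift_apply, h]
  have s2 : shift S (t α) t η = t α * t (β * ω) := by
    rw [shift_apply, t.rightHom_section, hη']
  change (simplexU S c t (shift S (t α) t) (shift S (t α * t β) t)).1 y -
    (simplexU S c t (shift S (t (α * β)) t) (shift S (t α * t β) t)).1 y = _
  -- The right bracketing gives the factors `t(α) F(β, ω) t(α)⁻¹` and `F(α, βω)`; the left one gives
  -- `F(α, β)` and `F(αβ, ω)`.
  rw [simplexU_apply (g := F α (β * ω)) (h := S.conjAct (t α) (F β ω)),
    simplexU_apply (g := F (α * β) ω) (h := F α β)]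
  · ring
  · rw [s1 _ (by simp), hF, mul_assoc, hη]
  · rw [s1 _ (by simp), s1 _ (by simp), hF, mul_assoc]
  · change shift S (t α) t η = S.inl (F α (β * ω)) * t η
    rw [s2, hF, hη]
  · change shift S (t α * t β) t η = S.inl (S.conjAct (t α) (F β ω)) * shift S (t α) t η
    rw [s1 _ (by simp), s2, S.inl_conjAct_comm, mul_assoc, hF]
    group

/-- The `K^{2,0}` component is minus the composition cochain with a last argument depending on
`σ(y)`. The cocycle identity then removes all dependence on `y`. -/
theorem dH_simplexK (N : AbstractKernel S) (hc : ConjInvariant S c) {t : S.Section}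
    (ht : ∀ α, N.Psi α = S.conjAct (t α)) :
    dH S 2 0 (simplexK S c t) = constK S 3 ⟨N.compCochain c, (N.compCochain_mem hc).1⟩ := by
  obtain ⟨F, hF⟩ := exists_defect t
  have key : ∀ (a : Fin 2 → Q) (y : Fin 1 → Γ), ((simplexK S c t).1 a).1 y =
      -N.compCochain c ![a 0, a 1, (a 0 * a 1)⁻¹ * S.rightHom (y 0)] := by
    intro a y
    rw [simplexK_apply hF, N.compCochain_eq hc ht hF, neg_sub]
    rfl
  refine Subtype.ext (funext fun a => ?_)
  refine (inhomD_two_apply (rhoU S 0) (simplexK S c t).1 a).trans ?_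
  rw [rhoU_section S 0 t]
  refine Subtype.ext (funext fun y => ?_)
  change ((simplexK S c t).1 ![a 1, a 2]).1 (fun i => (t (a 0))⁻¹ * y i) -
    ((simplexK S c t).1 ![a 0 * a 1, a 2]).1 y + ((simplexK S c t).1 ![a 0, a 1 * a 2]).1 y -
    ((simplexK S c t).1 ![a 0, a 1]).1 y = N.compCochain c a
  have h0 : dR Q 3 (N.compCochain c) = 0 := (N.compCochain_mem hc).2
  set ω := (a 0 * a 1 * a 2)⁻¹ * S.rightHom (y 0) with hω
  -- The fourth argument is chosen so that `a 0 * a 1 * a 2 * ω = σ(y)`; four of the five terms then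
  -- match the horizontal coboundary and the fifth is the asserted constant.
  have h1 := congrFun h0 ![a 0, a 1, a 2, ω]
  rw [AbstractKernel.dR_three_apply] at h1
  simp only [Matrix.cons_val_zero, Matrix.cons_val_one, Matrix.cons_val, Pi.zero_apply] at h1
  simp only [key, Matrix.cons_val_zero, Matrix.cons_val_one, map_mul, map_inv,
    t.rightHom_section]
  have w1 : (a 1 * a 2)⁻¹ * ((a 0)⁻¹ * S.rightHom (y 0)) = ω := by rw [hω]; group
  have w2 : (a 0 * (a 1 * a 2))⁻¹ * S.rightHom (y 0) = ω := by rw [hω]; group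
  have w3 : (a 0 * a 1)⁻¹ * S.rightHom (y 0) = a 2 * ω := by rw [hω]; group
  have ha : a = ![a 0, a 1, a 2] := by ext i; fin_cases i <;> rfl
  rw [w1, w2, w3, ← hω, congrArg (N.compCochain c) ha]
  linarith

/-- The three components form a zigzag: vertical and horizontal parts cancel in bidegrees `(1, 2)`
and `(2, 1)`, and `(0, 3)` vanishes. The result is an equality of cochains, not only of classes. -/
theorem totD_totCochain (N : AbstractKernel S) (hc : ConjInvariant S c) {t : S.Section}
    (ht : ∀ α, N.Psi α = S.conjAct (t α)) :
    totD S (totCochain S c t) =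
      single S 3 0 (constK S 3 ⟨N.compCochain c, (N.compCochain_mem hc).1⟩) := by
  rw [totCochain, map_add, map_add, totD_single, totD_single, totD_single, dV_cocycleK,
    dH_cocycleK hc, dH_prismK hc, dH_simplexK N hc ht, map_zero, map_neg]
  module

theorem totCochain_mem (N : AbstractKernel S) (hc : ConjInvariant S c) {t : S.Section}
    (ht : ∀ α, N.Psi α = S.conjAct (t α)) :
    totCochain S c t ∈ (hochschildSerre S).Z 3 0 2 := by
  refine ⟨add_mem (add_mem ?_ ?_) ?_, ?_⟩
  · exact single_mem_FK S _ (by norm_num) (by norm_num)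
  · exact single_mem_FK S _ (by norm_num) (by norm_num)
  · exact single_mem_FK S _ (by norm_num) (by norm_num)
  · change totD S (totCochain S c t) ∈ (hochschildSerre S).FK (0 + 3) (0 + 2 + 1)
    rw [totD_totCochain N hc ht]
    exact single_mem_FK S _ (by norm_num) (by norm_num)

theorem restr_totCochain (hc : ConjInvariant S c) (t : S.Section) :
    restr S (totCochain S c t) = c.1 := by
  change resU S 2 ((comp S 0 2 (totCochain S c t)).1 Fin.elim0) = c.1
  rw [totCochain, map_add, map_add, single_same, single_ne S _ (by simp),
    single_ne S _ (by simp), add_zero, add_zero]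
  exact resU_cocycleU hc t

end TransgressionCochain

/-! ### Vertical cohomology in low degrees -/

section Vertical

theorem toHom_trivial_injective {G : Type*} [Group G] {n : ℕ} {f f' : (Fin n → G) → ℝ}
    (h : toHom (Representation.trivial ℝ G ℝ) f = toHom (Representation.trivial ℝ G ℝ) f') :
    f = f' := by
  have key : ∀ (f : (Fin n → G) → ℝ) (g : Fin n → G),
      toHom (Representation.trivial ℝ G ℝ) f (Fin.partialProd g) = f g := by
    intro f g
    simp only [toHom, Representation.trivial_apply, Fin.partialProd_right_inv]
  ext g
  rw [← key f, h, key]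

theorem toHom_pull {G H : Type*} [Group G] [Group H] (φ : G →* H) {n : ℕ}
    (f : (Fin n → H) → ℝ) (x : Fin (n + 1) → G) :
    toHom (Representation.trivial ℝ G ℝ) (pull φ n f) x =
      toHom (Representation.trivial ℝ H ℝ) f (fun i => φ (x i)) := by
  simp [toHom, pull]

theorem toHom_dR {G : Type*} [Group G] {n : ℕ} (f : (Fin n → G) → ℝ) :
    toHom (Representation.trivial ℝ G ℝ) (dR G n f) =
      altD G ℝ n (toHom (Representation.trivial ℝ G ℝ) f) := toHom_inhomD _ f

variable {G Γ Q : Type*} [Group G] [Group Γ] [Group Q] (S : GroupExtension G Γ Q)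

/-- By `G`-invariance the homogeneous form of the restriction is plain restriction along `S.inl`, so
coboundaries on `G` can be compared in homogeneous terms. -/
theorem toHom_resU (q : ℕ) (u : UU S q) (x : Fin (q + 1) → G) :
    toHom (Representation.trivial ℝ G ℝ) (resU S q u) x = u.1 (fun i => S.inl (x i)) := by
  have h1 := u.2.2 (x 0) (fun j => S.inl (Fin.partialProd
    (fun i : Fin q => (x i.castSucc)⁻¹ * x i.succ) j))
  have h3 : (fun j => S.inl (x 0) * S.inl (Fin.partialProd
      (fun i : Fin q => (x i.castSucc)⁻¹ * x i.succ) j)) = fun j => S.inl (x j) := by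
    funext j
    rw [← map_mul]
    exact congrArg S.inl (congrFun (Fin.partialProd_left_inv x) j)
  rw [h3] at h1
  exact h1.symm

theorem apply_eq_of_inl_mul {q : ℕ} (u : UU S q) {g : G} {x y : Fin (q + 1) → Γ}
    (h : ∀ i, y i = S.inl g * x i) : u.1 y = u.1 x := by
  rw [← u.2.2 g x]
  exact congrArg u.1 (funext h)

theorem nonempty_section : Nonempty S.Section :=
  ⟨⟨Function.surjInv S.rightHom_surjective, Function.surjInv_eq S.rightHom_surjective⟩⟩

variable {S}

/-- A cocycle of `U²` whose restriction to `G` is a bounded coboundary is a coboundary. -/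
theorem exists_dU_eq_of_resU_mem {u : UU S 2} (hu : dU S 2 u = 0) (hr : resU S 2 u ∈ Bb G 2) :
    ∃ w : UU S 1, dU S 1 w = u := by
  obtain ⟨τ⟩ := nonempty_section S
  obtain ⟨b, ⟨B, hB⟩, hb⟩ := hr
  obtain ⟨C, hC⟩ := u.2.1
  have hu0 : altD Γ ℝ 2 u.1 = 0 := congrArg Subtype.val hu
  -- The prism joins the retraction, viewed as a self-map of `Γ`, to the identity. Its coboundary is
  -- `u` minus the pull-back of the restriction of `u`, and `R` is a primitive of that pull-back.
  let P : (Fin 2 → Γ) → ℝ := prism u.1 (fun y => S.inl (retr S τ y)) (fun y => y)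
  let R : (Fin 2 → Γ) → ℝ := fun y =>
    toHom (Representation.trivial ℝ G ℝ) b (fun i => retr S τ (y i))
  refine ⟨⟨P + R, ⟨C + C + B, fun y => ?_⟩, fun g y => ?_⟩, Subtype.ext (funext fun y => ?_)⟩
  · exact (abs_add_le _ _).trans (add_le_add (prism_bound hC _ _ _) (hB _))
  · refine congrArg₂ (fun s t : ℝ => s + t) (congrArg₂ (fun s t : ℝ => s - t) ?_ ?_) ?_
    · refine apply_eq_of_inl_mul S u (g := g) fun i => ?_
      fin_cases i <;> simp [retr_inl_mul]
    · refine apply_eq_of_inl_mul S u (g := g) fun i => ?_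
      fin_cases i <;> simp [retr_inl_mul]
    · simp only [R, retr_inl_mul]
      exact toHom_trivial_mul_left b g _
  · change altD Γ ℝ 1 (P + R) y = u.1 y
    have h1 : altD Γ ℝ 1 R y = altD G ℝ 1 (toHom (Representation.trivial ℝ G ℝ) b)
        (fun i => retr S τ (y i)) := rfl
    rw [map_add, Pi.add_apply, altD_prism hu0, h1, ← toHom_dR, hb, toHom_resU]
    exact sub_add_cancel _ _

/-- If the translates of a cocycle of `U²` are cohomologous to it, its restriction to `G` has an
invariant class. -/
theorem pull_resU_sub_mem {u : UU S 2} (hu : dU S 2 u = 0) {γ : Γ} {w : UU S 1}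
    (hw : transl S 2 γ u - u = dU S 1 w) :
    pull (S.conjAct γ⁻¹).toMonoidHom 2 (resU S 2 u) - resU S 2 u ∈ Bb G 2 := by
  have hu0 : altD Γ ℝ 2 u.1 = 0 := congrArg Subtype.val hu
  obtain ⟨C, hC⟩ := u.2.1
  obtain ⟨B, hB⟩ := w.2.1
  let φ := S.conjAct γ⁻¹
  have hφ : ∀ g, S.inl (φ g) = γ⁻¹ * S.inl g * γ := fun g =>
    (S.inl_conjAct_comm (e := γ⁻¹) (n := g)).trans (by rw [inv_inv])
  -- Translation by `γ⁻¹` and conjugation `g ↦ γ⁻¹ g γ` differ by right multiplication by `γ`; this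
  -- prism corrects for it, so that `m` has the required coboundary.
  let P : (Fin 2 → G) → ℝ := prism u.1 (fun g => S.inl (φ g)) (fun g => γ⁻¹ * S.inl g)
  let m : (Fin 2 → G) → ℝ := fun g => w.1 (fun i => S.inl (g i)) - P g
  have hm : ∀ (g : G) x, m (fun i => g * x i) = m x := by
    intro g x
    refine congrArg₂ (fun s t : ℝ => s - t) ?_ (congrArg₂ (fun s t : ℝ => s - t) ?_ ?_)
    · exact apply_eq_of_inl_mul S w (g := g) fun i => map_mul _ _ _
    · refine apply_eq_of_inl_mul S u (g := φ g) fun i => ?_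
      fin_cases i <;> simp [hφ, mul_assoc]
    · refine apply_eq_of_inl_mul S u (g := φ g) fun i => ?_
      fin_cases i <;> simp [hφ, mul_assoc]
  -- The primitive `m` is left invariant, so it is the homogeneous form of its values at `(1, g)`.
  let b : (Fin 1 → G) → ℝ := fun g => m ![1, g 0]
  have hb : toHom (Representation.trivial ℝ G ℝ) b = m := by
    funext x
    rw [← hm (x 0)⁻¹ x]
    change m ![1, (x 0)⁻¹ * x 1] = _
    congr 1
    ext i; fin_cases i <;> simp
  refine ⟨b, ⟨B + (C + C), fun g => (abs_sub _ _).trans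
    (add_le_add (hB _) (prism_bound hC _ _ _))⟩, toHom_trivial_injective (funext fun x => ?_)⟩
  have hx := congrFun (congrArg Subtype.val hw) (fun i => S.inl (x i))
  change u.1 (fun i => γ⁻¹ * S.inl (x i)) - u.1 (fun i => S.inl (x i)) =
    altD G ℝ 1 (fun g => w.1 (fun i => S.inl (g i))) x at hx
  have hP : altD G ℝ 1 P x = _ := altD_prism hu0 _ _ x
  have e1 : altD G ℝ 1 m x = altD G ℝ 1 (fun g => w.1 (fun i => S.inl (g i))) x -
      altD G ℝ 1 P x := by
    rw [← Pi.sub_apply, ← map_sub]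
    rfl
  rw [toHom_dR, hb, e1, hP, ← hx]
  change _ = toHom (Representation.trivial ℝ G ℝ) (pull φ.toMonoidHom 2 (resU S 2 u)) x -
    toHom (Representation.trivial ℝ G ℝ) (resU S 2 u) x
  rw [toHom_pull, toHom_resU, toHom_resU]
  simp only [MulEquiv.toMonoidHom_eq_coe, MonoidHom.coe_coe]
  ring

theorem apply_eq_sub_of_dU_eq_zero {u : UU S 1} (hu : dU S 1 u = 0) (x y : Γ) :
    u.1 ![x, y] = u.1 ![1, y] - u.1 ![1, x] := by
  have h := congrFun (congrArg Subtype.val hu) ![1, x, y]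
  change altD Γ ℝ 1 u.1 ![1, x, y] = 0 at h
  rw [altD_one_apply] at h
  change u.1 ![x, y] - u.1 ![1, y] + u.1 ![1, x] = 0 at h
  linarith

/-- With `v(x) = u(1, x)`, the cocycle relation and `G`-invariance give `v(g x) = v(x) + v(g)`. So
`v` restricts to a bounded homomorphism on `G`, which vanishes. -/
theorem apply_inl_mul_of_dU_eq_zero {u : UU S 1} (hu : dU S 1 u = 0) (g : G) (x : Γ) :
    u.1 ![1, S.inl g * x] = u.1 ![1, x] := by
  have key : ∀ (g : G) (x : Γ), u.1 ![1, S.inl g * x] = u.1 ![1, x] + u.1 ![1, S.inl g] := by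
    intro g x
    have h1 := apply_eq_sub_of_dU_eq_zero hu (S.inl g) (S.inl g * x)
    have h2 : u.1 ![S.inl g, S.inl g * x] = u.1 ![1, x] :=
      apply_eq_of_inl_mul S u (g := g) fun i => by fin_cases i <;> simp
    linarith
  have hpow : ∀ k : ℕ, u.1 ![1, S.inl (g ^ 2 ^ k)] = 2 ^ k * u.1 ![1, S.inl g] := by
    intro k
    induction k with
    | zero => simp
    | succ k ih =>
      rw [pow_succ, pow_mul, pow_two, map_mul, key, ih]
      ring
  obtain ⟨C, hC⟩ := u.2.1
  rw [key, eq_zero_of_bdd_nat (C := C) (t := u.1 ![1, S.inl g])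
    (fun k => by rw [← hpow]; exact hC _), add_zero]

/-- The vertical cohomology of the double complex vanishes in degree one. -/
theorem exists_dV_eq {p : ℕ} {k : KK S p 1} (hk : dV S p 1 k = 0) :
    ∃ v : KK S p 0, dV S p 0 v = k := by
  have hk' : ∀ a, dU S 1 (k.1 a) = 0 := fun a => congrFun (congrArg Subtype.val hk) a
  obtain ⟨C, hC⟩ := k.2
  -- The primitive is evaluation with first vertex `1`. Its `G`-invariance is the vanishing of
  -- bounded homomorphisms, and the uniform bound on `k` is inherited.
  refine ⟨⟨fun a => ⟨fun y => (k.1 a).1 ![1, y 0], ⟨C, fun y => hC _ _⟩, fun g y =>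
    apply_inl_mul_of_dU_eq_zero (hk' a) g (y 0)⟩, ⟨C, fun a y => hC _ _⟩⟩, ?_⟩
  refine Subtype.ext (funext fun a => Subtype.ext (funext fun y => ?_))
  change altD Γ ℝ 0 (fun y : Fin 1 → Γ => (k.1 a).1 ![1, y 0]) y = (k.1 a).1 y
  have hy : y = ![y 0, y 1] := by ext i; fin_cases i <;> rfl
  rw [altD_zero_apply, congrArg (k.1 a).1 hy]
  exact (apply_eq_sub_of_dU_eq_zero (hk' a) (y 0) (y 1)).symm

/-- The vertical cocycles in `K^{p,0}` are the cochains with constant values. -/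
theorem exists_constK_eq {p : ℕ} {k : KK S p 0} (hk : dV S p 0 k = 0) :
    ∃ b : Cb Q p, constK S p b = k := by
  obtain ⟨C, hC⟩ := k.2
  refine ⟨⟨fun a => (k.1 a).1 ![1], C, fun a => hC _ _⟩, ?_⟩
  refine Subtype.ext (funext fun a => Subtype.ext (funext fun y => ?_))
  have h := congrFun (congrArg Subtype.val (congrFun (congrArg Subtype.val hk) a)) ![y 0, 1]
  change altD Γ ℝ 0 (k.1 a).1 ![y 0, 1] = 0 at h
  rw [altD_zero_apply] at h
  have hy : y = ![y 0] := by ext i; fin_cases i; rfl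
  change (k.1 a).1 ![1] = (k.1 a).1 y
  rw [congrArg (k.1 a).1 hy]
  exact sub_eq_zero.mp h

theorem dH_constK_eq_zero_iff {p : ℕ} {b : Cb Q p} :
    dH S p 0 (constK S p b) = 0 ↔ dR Q p b.1 = 0 := by
  constructor
  · intro h
    have h1 := (dH_constK S p b).symm.trans (congrArg Subtype.val h)
    funext a
    exact congrFun (congrArg Subtype.val (congrFun h1 a)) 1
  · intro h
    refine Subtype.ext ?_
    rw [dH_constK, h]
    funext a
    exact map_zero (constU S)

end Vertical

/-! ### The two edge isomorphisms and the third differential -/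

section EdgeIsomorphisms

variable {G Γ Q : Type*} [Group G] [Group Γ] [Group Q] {S : GroupExtension G Γ Q}

theorem comp_eq_zero_of_gr {x : TotFam S} {n : ℤ} (hx : x ∈ (hochschildSerre S).gr n) {p q : ℕ}
    (h : (p : ℤ) + q ≠ n) : comp S p q x = 0 := hx p q h

theorem comp_eq_zero_of_fil {x : TotFam S} {m : ℤ} (hx : x ∈ (hochschildSerre S).fil m)
    {p q : ℕ} (h : (p : ℤ) < m) : comp S p q x = 0 := hx p q (not_le.mpr h)

theorem dU_comp_eq_zero {x : TotFam S} (hx : x ∈ (hochschildSerre S).Z 3 0 2) :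
    dU S 2 ((comp S 0 2 x).1 Fin.elim0) = 0 := by
  have h1 : comp S 0 3 (totD S x) = 0 := comp_eq_zero_of_fil hx.2.1 (by norm_num)
  rw [totD_apply, hPart_zero, vPart_succ, zero_add, pow_zero, one_smul] at h1
  exact congrFun (congrArg Subtype.val h1) Fin.elim0

/-- The total coboundary lies in `F³`, so its `(1, 2)` component vanishes: each translate of
`x^{0,2}` differs from it by the vertical coboundary of a value of `x^{1,1}`. -/
theorem edge_mem_invariants (e : (hochschildSerre S).E 3 0 2) :
    edge S e ∈ Hb.invariants S 2 := by
  obtain ⟨⟨x, hx⟩, rfl⟩ := Submodule.mkQ_surjective _ e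
  intro γ
  have h1 : comp S 1 2 (totD S x) = 0 := comp_eq_zero_of_fil hx.2.1 (by norm_num)
  rw [totD_apply, hPart_succ, vPart_succ, pow_one, neg_one_smul, add_neg_eq_zero] at h1
  -- The inverse is used because translation by `γ⁻¹` restricts, up to a coboundary, to pull-back
  -- along conjugation by `γ`.
  have h2 := congrFun (congrArg Subtype.val h1) ![S.rightHom γ⁻¹]
  have h3 : transl S 2 γ⁻¹ ((comp S 0 2 x).1 Fin.elim0) - (comp S 0 2 x).1 Fin.elim0 =
      dU S 1 ((comp S 1 1 x).1 ![S.rightHom γ⁻¹]) := by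
    rw [← rhoU_rightHom]
    exact (inhomD_zero_apply (rhoU S 2) (comp S 0 2 x).1 ![S.rightHom γ⁻¹]).symm.trans h2
  have h4 := pull_resU_sub_mem (dU_comp_eq_zero hx) h3
  rw [inv_inv] at h4
  exact (Submodule.Quotient.eq _).mpr h4

/-- A trivial restriction makes `x^{0,2}` a vertical coboundary of some `w` in `U¹`. Subtracting the
total coboundary of `w` pushes `x` into `F¹`. -/
theorem edge_injective : Function.Injective (edge S) := by
  rw [injective_iff_map_eq_zero]
  intro e he
  obtain ⟨⟨x, hx⟩, rfl⟩ := Submodule.mkQ_surjective _ e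
  have hB : restr S x ∈ Bb G 2 :=
    (Submodule.Quotient.mk_eq_zero ((Bb G 2).comap (Zb G 2).subtype)).mp he
  obtain ⟨w, hw⟩ := exists_dU_eq_of_resU_mem (dU_comp_eq_zero hx) hB
  obtain ⟨C, hC⟩ := w.2.1
  let k : KK S 0 1 := ⟨fun _ => w, C, fun _ => hC⟩
  have hk : dV S 0 1 k = comp S 0 2 x := Subtype.ext (funext fun a => by
    rw [Subsingleton.elim a Fin.elim0]
    exact hw)
  have hs : totD S (single S 0 1 k) = single S 1 1 (dH S 0 1 k) + single S 0 2 (comp S 0 2 x) := by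
    rw [totD_single, hk, pow_zero, one_smul]
  have hs2 : totD S (single S 0 1 k) ∈ (hochschildSerre S).FK 0 2 := by
    rw [hs]
    exact add_mem (single_mem_FK S _ (by norm_num) (by norm_num))
      (single_mem_FK S _ (by norm_num) (by norm_num))
  have hx2 : x ∈ (hochschildSerre S).FK 0 2 := hx.1
  have hxd : totD S x ∈ (hochschildSerre S).FK 3 3 := hx.2
  refine (Submodule.Quotient.mk_eq_zero _).mpr ?_
  change x ∈ (hochschildSerre S).Z (3 - 1) (0 + 1) (2 - 1) ⊔ (hochschildSerre S).B (3 - 1) 0 2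
  rw [← sub_add_cancel x (totD S (single S 0 1 k))]
  -- The difference lies in `Z₂^{1,1}`, with the same total coboundary as `x`; the subtracted part
  -- lies in `B₂^{0,2}`.
  refine Submodule.add_mem_sup ⟨⟨?_, ?_⟩, ?_⟩ ⟨hs2, single S 0 1 k, ?_, rfl⟩
  · intro p q hp
    obtain rfl : p = 0 := by
      change ¬((0 : ℤ) + 1 ≤ p) at hp
      omega
    by_cases hq : q = 2
    · subst hq
      rw [map_sub, hs, map_add, single_same, single_ne S _ (by simp), zero_add, sub_self]
    · exact comp_eq_zero_of_gr (sub_mem hx2.2 hs2.2) (by push_cast; omega)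
  · exact sub_mem hx2.2 hs2.2
  · change totD S (x - totD S (single S 0 1 k)) ∈ (hochschildSerre S).FK 3 3
    rw [map_sub, totD_totD, sub_zero]
    exact hxd
  · exact single_mem_FK S _ (by norm_num) (by norm_num)

/-- The class in `E₃^{0,2}` attached to an invariant class of `G`. -/
noncomputable def transgressionClass (N : AbstractKernel S) {t : S.Section}
    (ht : ∀ α, N.Psi α = S.conjAct (t α)) (x : Hb.invariants S 2) :
    (hochschildSerre S).E 3 0 2 :=
  Submodule.Quotient.mk ⟨totCochain S (homogRep G x) t,
    totCochain_mem N (homogRep_conjInvariant x) ht⟩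

theorem edge_transgressionClass (N : AbstractKernel S) {t : S.Section}
    (ht : ∀ α, N.Psi α = S.conjAct (t α)) (x : Hb.invariants S 2) :
    edge S (transgressionClass N ht x) = x := by
  have h : homogClass G (homogRep G x) = x :=
    (LinearEquiv.ofBijective (homogClass G) (homogClass_bijective G)).apply_symm_apply x
  refine Eq.trans ?_ h
  exact congrArg (Hb.mk G 2) (Subtype.ext (restr_totCochain (homogRep_conjInvariant x) t))

theorem dr_transgressionClass (N : AbstractKernel S) {t : S.Section}
    (ht : ∀ α, N.Psi α = S.conjAct (t α)) (x : Hb.invariants S 2) :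
    (hochschildSerre S).dr (r := 3) (p := 0) (q := 2) (p' := 3) (q' := 0)
      (by norm_num) (by norm_num) (transgressionClass N ht x) =
      inflation S (transgression N x) :=
  congrArg Submodule.Quotient.mk
    (Subtype.ext (totD_totCochain N (homogRep_conjInvariant x) ht))

/-- If `z` dies in `E₃^{3,0}`, it bounds some `y` in `F¹Tot²` up to `F⁴`. Vanishing in vertical
degree one removes `y^{1,1}`, leaving a vertical cocycle in `K^{2,0}`, that is, a bounded real
cochain bounding `z`. -/
theorem inflation_injective : Function.Injective (inflation S) := by
  rw [injective_iff_map_eq_zero]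
  intro e he
  obtain ⟨⟨z, hz⟩, rfl⟩ := Submodule.mkQ_surjective _ e
  have h0 : single S 3 0 (constK S 3 ⟨z, hz.1⟩) ∈
      (hochschildSerre S).Z (3 - 1) (3 + 1) (0 - 1) ⊔ (hochschildSerre S).B (3 - 1) 3 0 :=
    (Submodule.Quotient.mk_eq_zero (((hochschildSerre S).Z (3 - 1) (3 + 1) (0 - 1) ⊔
      (hochschildSerre S).B (3 - 1) 3 0).comap ((hochschildSerre S).Z 3 3 0).subtype)).mp he
  obtain ⟨v, hv, b, ⟨-, y, hy, hyb⟩, hvb⟩ := Submodule.mem_sup.mp h0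
  change totD S y = b at hyb
  have hy1 : y ∈ (hochschildSerre S).FK 1 2 := hy
  have hv1 : ∀ p q : ℕ, p ≤ 3 → comp S p q v = 0 := fun p q hp =>
    comp_eq_zero_of_fil hv.1.1 (by push_cast; omega)
  have hc : ∀ p q : ℕ, p ≤ 3 → comp S p q (totD S y) =
      comp S p q (single S 3 0 (constK S 3 ⟨z, hz.1⟩)) := by
    intro p q hp
    rw [← hvb, map_add, hv1 p q hp, zero_add, hyb]
  have y02 : comp S 0 2 y = 0 := comp_eq_zero_of_fil hy1.1 (by norm_num)
  have h12 := hc 1 2 (by norm_num)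
  have h21 := hc 2 1 (by norm_num)
  have h30 := hc 3 0 (by norm_num)
  rw [single_ne S _ (by simp), totD_apply, hPart_succ, vPart_succ, y02, map_zero, zero_add,
    pow_one, neg_one_smul, neg_eq_zero] at h12
  rw [single_ne S _ (by simp), totD_apply, hPart_succ, vPart_succ, neg_one_sq, one_smul] at h21
  rw [single_same, totD_apply, hPart_succ, vPart_zero, smul_zero, add_zero] at h30
  obtain ⟨u, hu⟩ := exists_dV_eq h12
  -- With `y^{1,1} = d_U u`, the `(2, 1)` equation says that `d_Π u + y^{2,0}` is vertically closed.
  -- Adding `d_Π u` does not change the horizontal coboundary.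
  rw [← hu, ← dV_dH, ← map_add] at h21
  obtain ⟨c, hc⟩ := exists_constK_eq h21
  have h1 : dH S 2 0 (constK S 2 c) = constK S 3 ⟨z, hz.1⟩ := by
    rw [hc, map_add, dH_dH]
    exact (zero_add _).trans h30
  have h2 := (dH_constK S 2 c).symm.trans (congrArg Subtype.val h1)
  refine (Submodule.Quotient.mk_eq_zero _).mpr ⟨c.1, c.2, funext fun a => ?_⟩
  exact congrFun (congrArg Subtype.val (congrFun h2 a)) 1

/-- An element of `F³Tot³` has only its `K^{3,0}` component. Since its coboundary lies in `F⁶`, the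
`(3, 1)` component makes it constant-valued and the `(4, 0)` component makes it a cocycle on `Π`. -/
theorem inflation_surjective : Function.Surjective (inflation S) := by
  intro e
  obtain ⟨⟨x, hx⟩, rfl⟩ := Submodule.mkQ_surjective _ e
  have hx3 : x ∈ (hochschildSerre S).FK 3 3 := hx.1
  have hd : totD S x ∈ (hochschildSerre S).FK 6 4 := hx.2
  have hsupp : x = single S 3 0 (comp S 3 0 x) := by
    refine TotFam.ext fun p q => ?_
    by_cases h : p = 3 ∧ q = 0
    · obtain ⟨rfl, rfl⟩ := h
      rw [single_same]
    · rw [single_ne S _ h]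
      by_cases hp : p < 3
      · exact comp_eq_zero_of_fil hx3.1 (by omega)
      · exact comp_eq_zero_of_gr hx3.2 (by omega)
  have h31 : comp S 3 1 (totD S x) = 0 := comp_eq_zero_of_fil hd.1 (by norm_num)
  have h40 : comp S 4 0 (totD S x) = 0 := comp_eq_zero_of_fil hd.1 (by norm_num)
  have x21 : comp S 2 1 x = 0 := comp_eq_zero_of_fil hx3.1 (by norm_num)
  rw [totD_apply, hPart_succ, vPart_succ, x21, map_zero, zero_add,
    (Odd.neg_one_pow (by decide) : (-1 : ℝ) ^ 3 = -1), neg_one_smul, neg_eq_zero] at h31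
  rw [totD_apply, hPart_succ, vPart_zero, smul_zero, add_zero] at h40
  obtain ⟨b, hb⟩ := exists_constK_eq h31
  rw [← hb, dH_constK_eq_zero_iff] at h40
  refine ⟨Hb.mk Q 3 ⟨b.1, b.2, h40⟩, ?_⟩
  refine congrArg Submodule.Quotient.mk (Subtype.ext ?_)
  change single S 3 0 (constK S 3 b) = x
  rw [hb, ← hsupp]

end EdgeIsomorphisms

end BddCoh

/-! ### Transgression as the third differential. -/

theorem mainTheorem7 {G Γ Q : Type*} [Group G] [Group Γ] [Group Q] (S : GroupExtension G Γ Q)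
    (N : BddCoh.AbstractKernel S) :
    ∃ (ι : (BddCoh.hochschildSerre S).E 3 0 2 ≃ₗ[ℝ] BddCoh.Hb.invariants S 2)
      (κ : BddCoh.Hb Q 3 ≃ₗ[ℝ] (BddCoh.hochschildSerre S).E 3 3 0),
      (∀ e, (ι e : BddCoh.Hb G 2) = BddCoh.edge S e) ∧
      (∀ y, κ y = BddCoh.inflation S y) ∧
      BddCoh.transgression N = κ.symm.toLinearMap ∘ₗ
        (BddCoh.hochschildSerre S).dr (r := 3) (p := 0) (q := 2) (p' := 3) (q' := 0)
          (by norm_num) (by norm_num) ∘ₗ ι.symm.toLinearMap := by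
  obtain ⟨t, ht⟩ := N.exists_section
  let ι := LinearEquiv.ofBijective
    ((BddCoh.edge S).codRestrict (BddCoh.Hb.invariants S 2) BddCoh.edge_mem_invariants)
    ⟨fun e e' h => BddCoh.edge_injective (congrArg Subtype.val h), fun x =>
      ⟨BddCoh.transgressionClass N ht x, Subtype.ext (BddCoh.edge_transgressionClass N ht x)⟩⟩
  let κ := LinearEquiv.ofBijective (BddCoh.inflation S)
    ⟨BddCoh.inflation_injective, BddCoh.inflation_surjective⟩
  refine ⟨ι, κ, fun _ => rfl, fun _ => rfl, LinearMap.ext fun x => ?_⟩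
  -- By injectivity of `ι`, the explicit lift is the inverse image of `x`, whatever section `t` was
  -- chosen; its third differential has already been computed.
  have hx : ι.symm x = BddCoh.transgressionClass N ht x :=
    ι.symm_apply_eq.mpr (Subtype.ext (BddCoh.edge_transgressionClass N ht x).symm)
  refine κ.eq_symm_apply.mpr ?_
  exact (BddCoh.dr_transgressionClass N ht x).symm.trans (congrArg _ hx.symm)
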